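/- Theorem 3.1. Let $k$ be an algebraically closed field of characteristic $2$. A variety is an integral separated scheme of finite type over $k$, and a point is a closed point; for a point $P$ of a $k$-scheme $X$ of finite type, $T_P(X)$ is the Zariski tangent space and $(X,P)^{\wedge}:=\operatorname{Spec}\,(\mathcal O_{X,P})^{\wedge}$, where $(\mathcal O_{X,P})^{\wedge}$ is the completion of $\mathcal O_{X,P}$ with respect to its maximal ideal. For a commutative $k$-algebra $R$, let $$(\gamma^R)^*: R[[u_1,v_1,u_2,v_2,w,y]]\to R[[x_1,x_2,z]]$$ be the $R$-algebra homomorphism given by the substitution $$u_1\mapsto x_1^2,\quad v_1\mapsto x_1z,\quad u_2\mapsto x_2^2,\quad v_2\mapsto x_2z,\quad w\mapsto x_1x_2z,\quad y\mapsto z,$$ put $\Gamma^R:=\operatorname{Spec}\bigl(R[[u_1,v_1,u_2,v_2,w,y]]/\operatorname{Ker}(\gamma^R)^*\bigr)$, and let $\gamma^R:\operatorname{Spec}R[[x_1,x_2,z]]\to\Gamma^R$ be the induced morphism. Let $V$ be a smooth variety of dimension $l\ge 3$, and let $\varphi:V\to W$ be a morphism over $k$ to a smooth variety $W$. Suppose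 that $H\subset V$ is a smooth hypersurface (a closed subscheme, smooth over $k$ of dimension $l-1$) such that, at every point $P$ of $H$, the kernel of $$d_P\varphi: T_P(V)\to T_{\varphi(P)}(W)$$ is of dimension $2$ and is contained in $T_P(H)$. Let $P$ be a point of $H$, and put $R:=k[[x_3,\dots,x_{l-1}]]$, the ring of formal power series in $l-3$ variables (so $R=k$ if $l=3$). Then there exists an isomorphism over $k$ $$\iota:(V,P)^{\wedge}\;\xrightarrow{\ \sim\ }\;\operatorname{Spec}R[[x_1,x_2,z]]$$ with the following properties: (i) $\iota$ maps the divisor $(H,P)^{\wedge}$ of $(V,P)^{\wedge}$ isomorphically onto the divisor of $\operatorname{Spec}R[[x_1,x_2,z]]$ given by $z=0$; (ii) there exists a unique morphism $\psi:\Gamma^R\to(W,\varphi(P))^{\wedge}$ over $k$ such that the formal completion $\varphi_P^{\wedge}:(V,P)^{\wedge}\to(W,\varphi(P))^{\wedge}$ of $\varphi$ at $P$ satisfies $$\varphi_P^{\wedge}=\psi\circ\gamma^R\circ\iota .$$ -/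

import Mathlib

universe u

open CategoryTheory AlgebraicGeometry

noncomputable section

namespace InsepMap

/-! ### Varieties, tangent spaces and formal completions over a field -/

section Schemes

variable {k : Type u} [Field k]

/-- A variety over `k`: an integral separated scheme of finite type over `k`. -/
structure IsVariety (X : Over (Spec (.of k))) : Prop where
  isIntegral : IsIntegral X.left
  isSeparated : IsSeparated X.hom
  locallyOfFiniteType : LocallyOfFiniteType X.hom
  quasiCompact : QuasiCompact X.hom

/-- The local ring `𝒪_{X,x}` of a `k`-scheme is a `k`-algebra through the structure morphism. -/
instance stalkAlgebra (X : Over (Spec (.of k))) (x : X.left) :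
    Algebra k (X.left.presheaf.stalk x) :=
  ((X.left.presheaf.germ ⊤ x trivial).hom.comp
    (X.hom.appTop.hom.comp (Scheme.ΓSpecIso (.of k)).inv.hom)).toAlgebra

/-- The pull-back homomorphism `𝒪_{Y,f(x)} → 𝒪_{X,x}` of local `k`-algebras. -/
def stalkPullback {X Y : Over (Spec (.of k))} (f : X ⟶ Y) (x : X.left) :
    Y.left.presheaf.stalk (f.left x) →ₐ[k] X.left.presheaf.stalk x where
  __ := (f.left.stalkMap x).hom
  commutes' c := by
    have h : Y.hom.appTop ≫ f.left.appTop = X.hom.appTop := by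
      rw [← Scheme.Hom.comp_appTop, Over.w f]
    have h2 := f.left.germ_stalkMap_apply ⊤ x trivial
      (Y.hom.appTop.hom ((Scheme.ΓSpecIso (.of k)).inv.hom c))
    refine h2.trans ?_
    change _ = (X.left.presheaf.germ ⊤ x trivial).hom
      (X.hom.appTop.hom ((Scheme.ΓSpecIso (.of k)).inv.hom c))
    rw [← h]
    rfl

instance isLocalHom_stalkPullback {X Y : Over (Spec (.of k))} (f : X ⟶ Y) (x : X.left) :
    IsLocalHom (stalkPullback f x) :=
  ⟨fun a ha => (inferInstance : IsLocalHom (f.left.stalkMap x).hom).map_nonunit a ha⟩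

/-- A local homomorphism pulls the maximal ideal back to the maximal ideal. -/
theorem maximalIdeal_le_comap {A B : Type u} [CommRing A] [CommRing B] [IsLocalRing A]
    [IsLocalRing B] [Algebra k A] [Algebra k B] (f : A →ₐ[k] B) [IsLocalHom f] :
    IsLocalRing.maximalIdeal A ≤ (IsLocalRing.maximalIdeal B).comap f :=
  fun a ha hfa => ha ((isUnit_map_iff f a).mp hfa)

/-- The Zariski tangent space `T_x(X) = (𝔪_x / 𝔪_x²)^∨` at a `k`-rational point; over an
algebraically closed field, every closed point of a scheme of finite type is one. -/
abbrev TangentSpace (X : Over (Spec (.of k))) (x : X.left) : Type u :=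
  Module.Dual k (IsLocalRing.CotangentSpace (X.left.presheaf.stalk x))

/-- The differential `d_x f : T_x(X) → T_{f(x)}(Y)`, the transpose of the `k`-linear map
`𝔪_{f(x)} / 𝔪_{f(x)}² → 𝔪_x / 𝔪_x²` induced by pull-back of functions. -/
def tangentMap {X Y : Over (Spec (.of k))} (f : X ⟶ Y) (x : X.left) :
    TangentSpace X x →ₗ[k] TangentSpace Y (f.left x) :=
  (Ideal.mapCotangent _ _ (stalkPullback f x) (maximalIdeal_le_comap _)).dualMap

/-- The formal completion of a local ring. -/
abbrev Completion (A : Type u) [CommRing A] [IsLocalRing A] : Type u :=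
  AdicCompletion (IsLocalRing.maximalIdeal A) A

section CompletionMap

variable {A B : Type u} [CommRing A] [CommRing B] [IsLocalRing A] [IsLocalRing B]
  [Algebra k A] [Algebra k B] (f : A →ₐ[k] B) [IsLocalHom f]

/-- The map `A / 𝔪_A ^ n → B / 𝔪_B ^ n` induced by a local homomorphism `f : A → B`. -/
def quotientPowMap (n : ℕ) :
    A ⧸ IsLocalRing.maximalIdeal A ^ n →ₐ[k] B ⧸ IsLocalRing.maximalIdeal B ^ n :=
  Ideal.quotientMapₐ (IsLocalRing.maximalIdeal B ^ n) f
    ((Ideal.pow_right_mono (maximalIdeal_le_comap f) n).trans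
      (Ideal.le_comap_pow (f : A →+* B) n))

/-- The composite `Â → A / 𝔪_A ^ n → B / 𝔪_B ^ n`. -/
def completionMapAux (n : ℕ) : Completion A →ₐ[k] B ⧸ IsLocalRing.maximalIdeal B ^ n :=
  (quotientPowMap f n).comp
    ((AdicCompletion.evalₐ (IsLocalRing.maximalIdeal A) n).restrictScalars k)

theorem completionMapAux_compat {m n : ℕ} (hle : m ≤ n) :
    (Ideal.Quotient.factorₐ k (Ideal.pow_le_pow_right hle)).comp (completionMapAux f n) =
      completionMapAux f m := by
  ext x
  obtain ⟨r, rfl⟩ := AdicCompletion.mk_surjective (IsLocalRing.maximalIdeal A) A x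
  simp only [completionMapAux, AlgHom.comp_apply, AlgHom.restrictScalars_apply,
    AdicCompletion.evalₐ_mk]
  rw [← AdicCompletion.Ideal.mk_eq_mk _ hle r]
  rfl

/-- The map `Â → B̂` induced by a local homomorphism `f : A → B`, i.e. the inverse limit of the
maps `A / 𝔪_A ^ n → B / 𝔪_B ^ n`. -/
def completionMap : Completion A →ₐ[k] Completion B :=
  AdicCompletion.liftAlgHom (IsLocalRing.maximalIdeal B) (completionMapAux f)
    (completionMapAux_compat f)

end CompletionMap

/-- `Spec A` as a scheme over `k`, for a `k`-algebra `A`. -/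
def specOver (k : Type u) [Field k] (A : Type u) [CommRing A] [Algebra k A] :
    Over (Spec (.of k)) :=
  Over.mk (Spec.map (CommRingCat.ofHom (algebraMap k A)))

/-- The `k`-morphism `Spec B → Spec A` given by a homomorphism of `k`-algebras `A → B`. -/
def specOverMap {A B : Type u} [CommRing A] [CommRing B] [Algebra k A] [Algebra k B]
    (f : A →ₐ[k] B) : specOver k B ⟶ specOver k A :=
  Over.homMk (Spec.map (CommRingCat.ofHom f.toRingHom)) (by
    simp only [specOver, Over.mk_left, Over.mk_hom, ← Spec.map_comp, ← CommRingCat.ofHom_comp]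
    congr 2
    exact f.comp_algebraMap)

/-- The formal completion `(X, x)^ = Spec (𝒪_{X,x})^` of `X` at `x`. -/
def formalCompletion (X : Over (Spec (.of k))) (x : X.left) : Over (Spec (.of k)) :=
  specOver k (Completion (X.left.presheaf.stalk x))

/-- The formal completion `(X, x)^ → (Y, f(x))^` of a morphism `f` at `x`. -/
def formalCompletionMap {X Y : Over (Spec (.of k))} (f : X ⟶ Y) (x : X.left) :
    formalCompletion X x ⟶ formalCompletion Y (f.left x) :=
  specOverMap (completionMap (stalkPullback f x))

end Schemes

/-! ### The scheme `Γ^R` -/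

section Gamma

variable (R : Type u) [CommRing R]

/-- The images `x₁², x₁z, x₂², x₂z, x₁x₂z, z` of `u₁, v₁, u₂, v₂, w, y` in `R[[x₁, x₂, z]]`; the
variables `x₁, x₂, z` are `X 0, X 1, X 2`. -/
def gammaImage : Fin 6 → MvPowerSeries (Fin 3) R :=
  ![.X 0 ^ 2, .X 0 * .X 2, .X 1 ^ 2, .X 1 * .X 2, .X 0 * .X 1 * .X 2, .X 2]

theorem hasSubst_gammaImage : MvPowerSeries.HasSubst (gammaImage R) := by
  apply MvPowerSeries.hasSubst_of_constantCoeff_zero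
  intro s
  fin_cases s <;> simp [gammaImage]

/-- The homomorphism `(γ^R)^* : R[[u₁, v₁, u₂, v₂, w, y]] → R[[x₁, x₂, z]]`. -/
def gammaHom : MvPowerSeries (Fin 6) R →ₐ[R] MvPowerSeries (Fin 3) R :=
  MvPowerSeries.substAlgHom (hasSubst_gammaImage R)

/-- The coordinate ring `R[[u₁, v₁, u₂, v₂, w, y]] / Ker (γ^R)^*` of `Γ^R`. -/
abbrev GammaRing : Type u :=
  MvPowerSeries (Fin 6) R ⧸ RingHom.ker (gammaHom R)

variable (k : Type u) [Field k] [Algebra k R]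

/-- `Spec R[[x₁, x₂, z]]` -/
def sourceSpec : Over (Spec (.of k)) :=
  specOver k (MvPowerSeries (Fin 3) R)

/-- The closed subscheme `z = 0` of `Spec R[[x₁, x₂, z]]`. -/
def divisorZ : Over (Spec (.of k)) :=
  specOver k (MvPowerSeries (Fin 3) R ⧸ Ideal.span {(MvPowerSeries.X 2 : MvPowerSeries (Fin 3) R)})

/-- The inclusion of the closed subscheme `z = 0`. -/
def divisorZIncl : divisorZ R k ⟶ sourceSpec R k :=
  specOverMap (Ideal.Quotient.mkₐ k _)

/-- `Γ^R = Spec (R[[u₁, v₁, u₂, v₂, w, y]] / Ker (γ^R)^*)`, the scheme-theoretic image of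
`Spec R[[x₁, x₂, z]] → Spec R[[u₁, v₁, u₂, v₂, w, y]]`. -/
def gammaScheme : Over (Spec (.of k)) :=
  specOver k (GammaRing R)

/-- The morphism `γ^R : Spec R[[x₁, x₂, z]] → Γ^R`. -/
def gammaMap : sourceSpec R k ⟶ gammaScheme R k :=
  specOverMap ((Ideal.kerLiftAlg (gammaHom R)).restrictScalars k)

end Gamma

end InsepMap

end

noncomputable section
namespace InsepMap

/-! ### Coordinate systems and the formal completion of a smooth local ring -/

section FormalCoordinates

open MvPolynomial IsLocalRing

/-! Restrict `φ` to `H`. Since `ker d_Qφ` lies in `T_Q(H)`, the differential of `φ ∘ i` has a kernel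
of dimension exactly 2 at every closed point `Q` of `H`, hence constant rank `l - 3`. At `P` one can
therefore take coordinates on `H` of which `l - 3` are pulled back from `W`, complete them by two
functions `x₁, x₂`, lift everything to `V`, and add an element `z` vanishing on `H`
(`exists_adapted_coordinates`). Formal smoothness turns such coordinates into an isomorphism of the
completion with a power series ring (`IsCoordinateSystem.equiv`), and restriction to `H` becomes
setting `z = 0`.

Let `g` be pulled back from `W` to `H`. In the Jacobian matrix of the coordinates of `H`, replace
`x₁` by `g`. At each closed point near `P`, all columns except that of `x₂` vanish on the
2-dimensional kernel, and some nonzero vector of that kernel also kills `dx₂`; so the determinant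
vanishes at all closed points and is nilpotent. Cramer's rule over the domain of power series gives
`∂g/∂x₁ = 0`, and likewise `∂g/∂x₂ = 0` (`pderiv_stalkPullback_eq_zero`). The hypothesis at points
of `H` other than `P` is essential here.

In characteristic 2 it follows that the restriction to `z = 0` of any function pulled back from `W`
involves only even powers of `x₁` and `x₂`. The monomials divisible by `z`, together with those
without `z` and even in `x₁` and `x₂`, are exactly the products of `x₁², x₁z, x₂², x₂z, x₁x₂z, z`;
so the pull-back lands in the image of `(γ^R)^*` (`mem_range_gammaHom`). That image is the
coordinate ring of `Γ^R`, embedded in `R[[x₁, x₂, z]]`, whence `ψ` and its uniqueness. -/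

theorem mem_idealOfVars_iff_constantCoeff {σ R : Type*} [CommRing R] (p : MvPolynomial σ R) :
    p ∈ idealOfVars σ R ↔ constantCoeff p = 0 := by
  rw [← pow_one (idealOfVars σ R), mem_pow_idealOfVars_iff', constantCoeff_eq]
  refine ⟨fun h => h 0 (by simp), fun h x hx => ?_⟩
  have : x = 0 := by
    rw [← Finsupp.degree_eq_zero_iff]; omega
  rw [this, h]

theorem sub_linear_part_mem {σ R : Type*} [Fintype σ] [CommRing R] (p : MvPolynomial σ R) :
    p - C (constantCoeff p) - ∑ i, C (coeff (Finsupp.single i 1) p) * X i ∈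
      idealOfVars σ R ^ 2 := by
  classical
  rw [mem_pow_idealOfVars_iff']
  intro x hx
  have hx' : x.degree = 0 ∨ x.degree = 1 := by omega
  rcases hx' with h | h
  · rw [Finsupp.degree_eq_zero_iff] at h
    subst h
    simp [coeff_sum, coeff_C_mul, MvPolynomial.coeff_X, constantCoeff_eq]
  · obtain ⟨j, rfl⟩ : ∃ j, x = Finsupp.single j 1 := by
      have h' : x ∈ {d : σ →₀ ℕ | d.degree = 1} := h
      rw [← Finsupp.range_single_one] at h'
      exact ⟨h'.choose, h'.choose_spec.symm⟩
    have h0 : (0 : σ →₀ ℕ) ≠ Finsupp.single j 1 := by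
      intro h; simpa using (DFunLike.congr_fun h j)
    simp [coeff_sum, coeff_C_mul, MvPolynomial.coeff_X, coeff_C, h0, Finsupp.single_left_inj]

/-- Such a substitution acts trivially on the associated graded ring: in `Y(ab) - ab = (Y(a) - a)
Y(b) + a (Y(b) - b)` each term gains one order. -/
theorem aeval_sub_mem_pow {σ R : Type*} [CommRing R] {Y : σ → MvPolynomial σ R}
    (hY : ∀ i, Y i - X i ∈ idealOfVars σ R ^ 2) (d : ℕ) (p : MvPolynomial σ R)
    (hp : p ∈ idealOfVars σ R ^ d) : aeval Y p - p ∈ idealOfVars σ R ^ (d + 1) := by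
  have h2 : ∀ q : MvPolynomial σ R, aeval Y q - q ∈ idealOfVars σ R ^ 2 := by
    intro q
    have : (Ideal.Quotient.mkₐ R (idealOfVars σ R ^ 2)).comp (aeval Y) =
        Ideal.Quotient.mkₐ R (idealOfVars σ R ^ 2) := by
      ext i
      simpa using Ideal.Quotient.eq.mpr (hY i)
    exact Ideal.Quotient.eq.mp (DFunLike.congr_fun this q)
  induction d generalizing p with
  | zero => exact Ideal.pow_le_pow_right (by norm_num) (h2 p)
  | succ d ih =>
    rw [pow_succ] at hp
    refine Submodule.mul_induction_on hp (fun a ha b hb => ?_) (fun a b ha hb => ?_)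
    · have hYb : aeval Y b ∈ idealOfVars σ R := by
        have := Ideal.pow_le_self two_ne_zero (h2 b)
        simpa using add_mem this hb
      have e : aeval Y (a * b) - a * b =
          (aeval Y a - a) * aeval Y b + a * (aeval Y b - b) := by
        rw [map_mul]; ring
      rw [e]
      refine add_mem ?_ ?_
      · rw [pow_succ]; exact Ideal.mul_mem_mul (ih a ha) hYb
      · rw [show d + 1 + 1 = d + 2 from rfl, pow_add]; exact Ideal.mul_mem_mul ha (h2 b)
    · rw [map_add, add_sub_add_comm]; exact add_mem ha hb

/-- A finite family of elements of a local `k`-algebra with residue field `k` which generates the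
maximal ideal and is linearly independent modulo its square. -/
structure IsCoordinateSystem (k : Type*) [Field k] {σ : Type*} [Fintype σ] {O : Type*}
    [CommRing O] [IsLocalRing O] [Algebra k O] (x : σ → O) : Prop where
  residue : ∀ a : O, ∃ c : k, a - algebraMap k O c ∈ maximalIdeal O
  span_eq : Ideal.span (Set.range x) = maximalIdeal O
  indep : ∀ c : σ → k, ∑ i, c i • x i ∈ maximalIdeal O ^ 2 → c = 0

namespace IsCoordinateSystem

variable {k : Type*} [Field k] {σ : Type*} [Fintype σ] {O : Type*}
  [CommRing O] [IsLocalRing O] [Algebra k O] {x : σ → O}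

theorem mem (h : IsCoordinateSystem k x) (i : σ) : x i ∈ maximalIdeal O :=
  h.span_eq ▸ Ideal.subset_span ⟨i, rfl⟩

theorem map_idealOfVars (h : IsCoordinateSystem k x) :
    (idealOfVars σ k).map (aeval (R := k) x) = maximalIdeal O := by
  rw [← h.span_eq, idealOfVars, Ideal.map_span, ← Set.range_comp]
  congr 1
  ext; simp

theorem aeval_mem_pow (h : IsCoordinateSystem k x) {N : ℕ} {p : MvPolynomial σ k}
    (hp : p ∈ idealOfVars σ k ^ N) : aeval x p ∈ maximalIdeal O ^ N := by
  rw [← h.map_idealOfVars, ← Ideal.map_pow]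
  exact Ideal.mem_map_of_mem _ hp

theorem exists_aeval_sub_mem (h : IsCoordinateSystem k x) (N : ℕ) (a : O) :
    ∃ p : MvPolynomial σ k, aeval x p - a ∈ maximalIdeal O ^ N := by
  induction N generalizing a with
  | zero => exact ⟨0, by simp⟩
  | succ N ih =>
    obtain ⟨c, hc⟩ := h.residue a
    rw [← h.span_eq, Ideal.mem_span_range_iff_exists_fun] at hc
    obtain ⟨b, hb⟩ := hc
    choose q hq using fun i => ih (b i)
    refine ⟨C c + ∑ i, q i * X i, ?_⟩
    have e : aeval x (C c + ∑ i, q i * X i) - a = ∑ i, (aeval x (q i) - b i) * x i := by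
      simp only [map_add, algHom_C, map_sum, map_mul, aeval_X, sub_mul, Finset.sum_sub_distrib, hb]
      ring
    rw [e, pow_succ]
    exact sum_mem fun i _ => Ideal.mul_mem_mul (hq i) (h.mem i)

theorem constantCoeff_eq_zero (h : IsCoordinateSystem k x) {p : MvPolynomial σ k}
    (hp : aeval x p ∈ maximalIdeal O) : p ∈ idealOfVars σ k := by
  rw [mem_idealOfVars_iff_constantCoeff]
  by_contra hc
  have h1 : p - C (constantCoeff p) ∈ idealOfVars σ k := by
    rw [mem_idealOfVars_iff_constantCoeff]; simp
  have h2 := h.aeval_mem_pow (N := 1) (by simpa using h1)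
  rw [pow_one, map_sub, algHom_C] at h2
  have h3 : algebraMap k O (constantCoeff p) ∈ maximalIdeal O := by
    simpa using sub_mem hp h2
  exact (IsLocalRing.mem_maximalIdeal _).mp h3 ((IsUnit.mk0 _ hc).map (algebraMap k O))

/-- Up to order two, linear independence modulo `𝔪²` suffices; formal smoothness is needed only for
higher orders. -/
theorem mem_sq_of_aeval_mem (h : IsCoordinateSystem k x) {p : MvPolynomial σ k}
    (hp : aeval x p ∈ maximalIdeal O ^ 2) : p ∈ idealOfVars σ k ^ 2 := by
  have h0 := (mem_idealOfVars_iff_constantCoeff p).mp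
    (h.constantCoeff_eq_zero (Ideal.pow_le_self two_ne_zero hp))
  have h1 := sub_linear_part_mem p
  rw [h0, C_0, sub_zero] at h1
  have h2 := sub_mem hp (h.aeval_mem_pow h1)
  have h3 : ∑ i, coeff (Finsupp.single i 1) p • x i ∈ maximalIdeal O ^ 2 := by
    simpa [Algebra.smul_def] using h2
  have h4 := h.indep _ h3
  have h5 : ∀ i, coeff (Finsupp.single i 1) p = 0 := fun i => congrFun h4 i
  simpa [h5] using h1

/-- On a formally smooth local algebra, a polynomial in the coordinates has the expected order. -/
theorem mem_pow_of_aeval_mem (h : IsCoordinateSystem k x) [Algebra.FormallySmooth k O]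
    {N : ℕ} {p : MvPolynomial σ k} (hp : aeval x p ∈ maximalIdeal O ^ N) :
    p ∈ idealOfVars σ k ^ N := by
  set I := idealOfVars σ k with hI
  set m := maximalIdeal O with hm
  -- Large enough to detect order `N` and also to compare lifts modulo the square of the ideal.
  let L := N + 2
  let f : MvPolynomial σ k ⧸ I ^ L →ₐ[k] O ⧸ m ^ L :=
    Ideal.quotientMapₐ (m ^ L) (aeval x) (fun q hq => h.aeval_mem_pow hq)
  have hf : Function.Surjective f := by
    intro b
    obtain ⟨a, rfl⟩ := Ideal.Quotient.mk_surjective b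
    obtain ⟨q, hq⟩ := h.exists_aeval_sub_mem L a
    exact ⟨Ideal.Quotient.mk _ q, Ideal.Quotient.eq.mpr hq⟩
  have hker : IsNilpotent (RingHom.ker f) := by
    refine ⟨L, ?_⟩
    have hle : RingHom.ker f ≤ I.map (Ideal.Quotient.mk (I ^ L)) := by
      intro b hb
      obtain ⟨q, rfl⟩ := Ideal.Quotient.mk_surjective b
      have hq : aeval x q ∈ m ^ L := Ideal.Quotient.eq_zero_iff_mem.mp hb
      exact Ideal.mem_map_of_mem _
        (h.constantCoeff_eq_zero (Ideal.pow_le_self (by simp [L]) hq))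
    rw [Submodule.zero_eq_bot, eq_bot_iff]
    calc RingHom.ker f ^ L ≤ (I.map (Ideal.Quotient.mk (I ^ L))) ^ L := Ideal.pow_right_mono hle L
      _ = (I ^ L).map (Ideal.Quotient.mk (I ^ L)) := (Ideal.map_pow _ _ _).symm
      _ = ⊥ := Ideal.map_quotient_self _
      _ ≤ ⊥ := le_rfl
  -- The surjection `f` has nilpotent kernel, so formal smoothness lifts `O → O / 𝔪 ^ L` through it.
  -- This lift inverts evaluation at `x` up to a substitution `X i ↦ Y i` that is the identity
  -- modulo `I ^ 2`.
  let s : O →ₐ[k] MvPolynomial σ k ⧸ I ^ L :=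
    Algebra.FormallySmooth.liftOfSurjective (Ideal.Quotient.mkₐ k (m ^ L)) f hf hker
  have hs : ∀ a, f (s a) = Ideal.Quotient.mk (m ^ L) a := fun a =>
    Algebra.FormallySmooth.liftOfSurjective_apply (Ideal.Quotient.mkₐ k (m ^ L)) f hf hker a
  choose Y hYs using fun i => Ideal.Quotient.mk_surjective (s (x i))
  have hY : ∀ i, Y i - X i ∈ I ^ 2 := by
    intro i
    apply h.mem_sq_of_aeval_mem
    have h1 := hs (x i)
    rw [← hYs] at h1
    have h2 : aeval x (Y i) - x i ∈ m ^ L := Ideal.Quotient.eq.mp h1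
    rw [map_sub, aeval_X]
    exact Ideal.pow_le_pow_right (by simp [L]) h2
  have hsm : ∀ a ∈ m, s a ∈ I.map (Ideal.Quotient.mk (I ^ L)) := by
    intro a ha
    obtain ⟨q, hq⟩ := Ideal.Quotient.mk_surjective (s a)
    have h1 := hs a
    rw [← hq] at h1 ⊢
    have h2 : aeval x q - a ∈ m ^ L := Ideal.Quotient.eq.mp h1
    have h3 : aeval x q ∈ m := by
      simpa using add_mem (Ideal.pow_le_self (by simp [L]) h2) ha
    exact Ideal.mem_map_of_mem _ (h.constantCoeff_eq_zero h3)
  have hYN : aeval Y p ∈ I ^ N := by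
    have h1 : s (aeval x p) = Ideal.Quotient.mk (I ^ L) (aeval Y p) := by
      have : s.comp (aeval x) = (Ideal.Quotient.mkₐ k (I ^ L)).comp (aeval Y) := by
        ext i; simp [hYs]
      exact DFunLike.congr_fun this p
    have h2 : s (aeval x p) ∈ (I.map (Ideal.Quotient.mk (I ^ L))) ^ N := by
      have h3 : m ≤ (I.map (Ideal.Quotient.mk (I ^ L))).comap s.toRingHom := hsm
      exact (Ideal.pow_right_mono h3 N).trans (Ideal.le_comap_pow s.toRingHom N) hp
    rw [h1, ← Ideal.map_pow, Ideal.mem_quotient_iff_mem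
      (Ideal.pow_le_pow_right (by simp [L]))] at h2
    exact h2
  -- Climb one order at a time: `Y(p)` has order at least `N`, and `Y(p) - p` has order at least `d
  -- + 1` once `p` has order at least `d`.
  have key : ∀ d ≤ N, p ∈ I ^ d := by
    intro d
    induction d with
    | zero => simp
    | succ d ih =>
      intro hd
      have h1 := aeval_sub_mem_pow hY d p (ih (by omega))
      have h2 := sub_mem (Ideal.pow_le_pow_right hd hYN) h1
      simpa using h2
  exact key N le_rfl

end IsCoordinateSystem

end FormalCoordinates

namespace IsCoordinateSystem

open MvPolynomial IsLocalRing

variable {k : Type*} [Field k] {σ : Type*} [Fintype σ] {O : Type*} [CommRing O] [IsLocalRing O]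
  [Algebra k O] {x : σ → O}

/-- Truncated evaluation of a power series at a coordinate system. -/
def evalTrunc (h : IsCoordinateSystem k x) (N : ℕ) :
    MvPowerSeries σ k →ₐ[k] O ⧸ maximalIdeal O ^ N :=
  (Ideal.quotientMapₐ (maximalIdeal O ^ N) (aeval x) (fun _ hq => h.aeval_mem_pow hq)).comp
    ((MvPowerSeries.truncTotalAlgHom σ k N).restrictScalars k)

theorem evalTrunc_apply (h : IsCoordinateSystem k x) (N : ℕ) (f : MvPowerSeries σ k) :
    h.evalTrunc N f = Ideal.Quotient.mk _ (aeval x (f.truncTotal N)) := rfl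

theorem evalTrunc_compat (h : IsCoordinateSystem k x) {m n : ℕ} (hle : m ≤ n) :
    (Ideal.Quotient.factorₐ k (Ideal.pow_le_pow_right hle)).comp (h.evalTrunc n) =
      h.evalTrunc m := by
  ext f
  change Ideal.Quotient.mk _ _ = Ideal.Quotient.mk _ _
  rw [Ideal.Quotient.eq, ← map_sub]
  exact h.aeval_mem_pow
    (MvPowerSeries.truncTotal_sub_truncTotal_mem_pow_idealOfVars hle le_rfl f)

/-- Evaluation of power series at a coordinate system, with values in the formal completion. -/
def evalHom (h : IsCoordinateSystem k x) :
    MvPowerSeries σ k →ₐ[k] AdicCompletion (maximalIdeal O) O :=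
  AdicCompletion.liftAlgHom (maximalIdeal O) h.evalTrunc h.evalTrunc_compat

theorem evalₐ_evalHom (h : IsCoordinateSystem k x) (N : ℕ) (f : MvPowerSeries σ k) :
    AdicCompletion.evalₐ (maximalIdeal O) N (h.evalHom f) =
      Ideal.Quotient.mk _ (aeval x (f.truncTotal N)) := by
  rw [evalHom, AdicCompletion.evalₐ_liftAlgHom, evalTrunc_apply]

theorem evalHom_coe (h : IsCoordinateSystem k x) (p : MvPolynomial σ k) :
    h.evalHom (p : MvPowerSeries σ k) = algebraMap O _ (aeval x p) := by
  refine AdicCompletion.ext_evalₐ fun N => ?_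
  rw [evalₐ_evalHom, AlgHom.commutes, Ideal.Quotient.algebraMap_eq, Ideal.Quotient.eq, ← map_sub]
  refine h.aeval_mem_pow ((mem_pow_idealOfVars_iff' _ _).mpr fun d hd => ?_)
  rw [coeff_sub, MvPowerSeries.coeff_truncTotal _ hd, coeff_coe, sub_self]

theorem evalHom_X (h : IsCoordinateSystem k x) (i : σ) :
    h.evalHom (MvPowerSeries.X i) = algebraMap O _ (x i) := by
  rw [← coe_X, evalHom_coe, aeval_X]

theorem coeff_eq_zero_of_evalₐ_eq_zero (h : IsCoordinateSystem k x) [Algebra.FormallySmooth k O]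
    {N : ℕ} {f : MvPowerSeries σ k}
    (hf : AdicCompletion.evalₐ (maximalIdeal O) N (h.evalHom f) = 0) {d : σ →₀ ℕ}
    (hd : d.degree < N) : f.coeff d = 0 := by
  rw [evalₐ_evalHom, Ideal.Quotient.eq_zero_iff_mem] at hf
  rw [← MvPowerSeries.coeff_truncTotal _ hd]
  exact (mem_pow_idealOfVars_iff' _ _).mp (h.mem_pow_of_aeval_mem hf) d hd

/-- Both halves rest on `mem_pow_of_aeval_mem`: the image modulo `𝔪 ^ N` determines all coefficients
of degree below `N`, so a series is recovered from its image, and polynomial approximations of a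
given element have stabilizing coefficients. -/
theorem evalHom_bijective (h : IsCoordinateSystem k x) [Algebra.FormallySmooth k O] :
    Function.Bijective h.evalHom := by
  constructor
  · rw [injective_iff_map_eq_zero]
    intro f hf
    ext d
    exact h.coeff_eq_zero_of_evalₐ_eq_zero (N := d.degree + 1) (by rw [hf, map_zero]) (by simp)
  · intro b
    have h1 : ∀ N, ∃ p : MvPolynomial σ k,
        Ideal.Quotient.mk (maximalIdeal O ^ N) (aeval x p) =
          AdicCompletion.evalₐ (maximalIdeal O) N b := by
      intro N
      obtain ⟨a, ha⟩ := Ideal.Quotient.mk_surjective (AdicCompletion.evalₐ (maximalIdeal O) N b)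
      obtain ⟨p, hp⟩ := h.exists_aeval_sub_mem N a
      exact ⟨p, by rw [← ha]; exact Ideal.Quotient.eq.mpr hp⟩
    choose p hp using h1
    have hcomp : ∀ {m n : ℕ}, m ≤ n → p n - p m ∈ idealOfVars σ k ^ m := by
      intro m n hmn
      apply h.mem_pow_of_aeval_mem
      obtain ⟨r, rfl⟩ := AdicCompletion.mk_surjective _ _ b
      have e1 := hp m
      have e2 := hp n
      rw [AdicCompletion.evalₐ_mk] at e1 e2
      rw [← AdicCompletion.Ideal.mk_eq_mk _ hmn r, Ideal.Quotient.eq] at e1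
      rw [Ideal.Quotient.eq] at e2
      have e3 := sub_mem (Ideal.pow_le_pow_right hmn e2) e1
      rwa [sub_sub_sub_cancel_right, ← map_sub] at e3
    -- The first approximation that determines the coefficient at `d` is the one modulo `𝔪 ^
    -- (d.degree + 1)`.
    let g : MvPowerSeries σ k := fun d => coeff d (p (d.degree + 1))
    have hg : ∀ d, g.coeff d = coeff d (p (d.degree + 1)) := fun d => rfl
    refine ⟨g, AdicCompletion.ext_evalₐ fun N => ?_⟩
    rw [evalₐ_evalHom, ← hp, Ideal.Quotient.eq, ← map_sub]
    refine h.aeval_mem_pow ((mem_pow_idealOfVars_iff' _ _).mpr fun d hd => ?_)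
    rw [coeff_sub, MvPowerSeries.coeff_truncTotal _ hd]
    have h2 := (mem_pow_idealOfVars_iff' _ _).mp (hcomp (Nat.succ_le_of_lt hd)) d (by simp)
    rw [coeff_sub, sub_eq_zero] at h2
    rw [h2, sub_eq_zero, hg]

/-- A coordinate system of a formally smooth local algebra identifies its formal completion with
a ring of formal power series. -/
def equiv (h : IsCoordinateSystem k x) [Algebra.FormallySmooth k O] :
    MvPowerSeries σ k ≃ₐ[k] AdicCompletion (maximalIdeal O) O :=
  AlgEquiv.ofBijective h.evalHom h.evalHom_bijective

theorem equiv_X (h : IsCoordinateSystem k x) [Algebra.FormallySmooth k O] (i : σ) :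
    h.equiv (MvPowerSeries.X i) = algebraMap O _ (x i) :=
  h.evalHom_X i

theorem equiv_symm_algebraMap (h : IsCoordinateSystem k x) [Algebra.FormallySmooth k O] (i : σ) :
    h.equiv.symm (algebraMap O _ (x i)) = MvPowerSeries.X i := by
  rw [← h.equiv_X, AlgEquiv.symm_apply_apply]

end IsCoordinateSystem

open MvPolynomial in
-- Power series form the adic completion of the polynomial ring, where the kernel of reduction
-- modulo `I ^ N` is generated by `I ^ N` because `I` is finitely generated.
theorem mem_pow_idealOfVars_smul_top {σ R : Type*} [Finite σ] [CommRing R] {N : ℕ}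
    {f : MvPowerSeries σ R} (hf : f.truncTotal N = 0) :
    f ∈ (idealOfVars σ R ^ N • ⊤ : Submodule (MvPolynomial σ R) (MvPowerSeries σ R)) := by
  have h1 : MvPowerSeries.toAdicCompletionAlgEquiv σ R f ∈
      (idealOfVars σ R ^ N • ⊤ : Submodule (MvPolynomial σ R) _) := by
    rw [AdicCompletion.pow_smul_top_eq_ker_eval (idealOfVars_fg σ R), LinearMap.mem_ker]
    change (MvPowerSeries.toAdicCompletion σ R f).val N = 0
    rw [MvPowerSeries.toAdicCompletion_apply_eq_mk_truncTotal, hf, map_zero]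
  have h2 := Submodule.mem_map_of_mem
    (f := (MvPowerSeries.toAdicCompletionAlgEquiv σ R).symm.toLinearMap) h1
  rw [Submodule.map_smul''] at h2
  have h3 := Submodule.smul_mono le_rfl le_top h2
  rwa [AlgEquiv.toLinearMap_apply, AlgEquiv.symm_apply_apply] at h3

open MvPolynomial IsLocalRing in
-- Continuity is automatic: the tail of `f` is a finite combination of polynomials of order at least
-- `N` with power series coefficients, so it dies modulo `𝔪 ^ N` although `F` is only assumed to be
-- an algebra homomorphism.
theorem evalₐ_eq_of_map_X {k σ B : Type*} [Field k] [Finite σ] [CommRing B] [IsLocalRing B]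
    [Algebra k B] (F : MvPowerSeries σ k →ₐ[k] AdicCompletion (maximalIdeal B) B) {y : σ → B}
    (hy : ∀ i, y i ∈ maximalIdeal B) (hF : ∀ i, F (MvPowerSeries.X i) = algebraMap B _ (y i))
    (N : ℕ) (f : MvPowerSeries σ k) :
    AdicCompletion.evalₐ (maximalIdeal B) N (F f) =
      Ideal.Quotient.mk _ (aeval y (f.truncTotal N)) := by
  let E : MvPowerSeries σ k →ₐ[k] B ⧸ maximalIdeal B ^ N :=
    ((AdicCompletion.evalₐ (maximalIdeal B) N).restrictScalars k).comp F
  have hE : ∀ p : MvPolynomial σ k, E (p : MvPowerSeries σ k) =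
      Ideal.Quotient.mk _ (aeval y p) := by
    have : E.comp (coeToMvPowerSeries.algHom k) =
        (Ideal.Quotient.mkₐ k (maximalIdeal B ^ N)).comp (aeval y) := by
      ext i
      simp [E, hF]
    intro p
    simpa [coeToMvPowerSeries.algHom_apply] using DFunLike.congr_fun this p
  have hpow : ∀ p ∈ idealOfVars σ k ^ N, aeval y p ∈ maximalIdeal B ^ N := by
    have h1 : idealOfVars σ k ≤ (maximalIdeal B).comap (aeval (R := k) y).toRingHom := by
      rw [idealOfVars, Ideal.span_le]
      rintro _ ⟨i, rfl⟩
      simpa using hy i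
    exact (Ideal.pow_right_mono h1 N).trans (Ideal.le_comap_pow _ N)
  have h0 : E (f - (f.truncTotal N : MvPolynomial σ k)) = 0 := by
    have h1 : f - (f.truncTotal N : MvPolynomial σ k) ∈
        (idealOfVars σ k ^ N • ⊤ : Submodule (MvPolynomial σ k) (MvPowerSeries σ k)) := by
      apply mem_pow_idealOfVars_smul_top
      ext d
      by_cases hd : d.degree < N
      · rw [MvPowerSeries.coeff_truncTotal _ hd, map_sub, coeff_coe,
          MvPowerSeries.coeff_truncTotal _ hd, sub_self, coeff_zero]
      · rw [MvPowerSeries.coeff_truncTotal_eq_zero _ (by omega), coeff_zero]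
    refine Submodule.smul_induction_on h1 (fun r hr g _ => ?_) (fun a b ha hb => ?_)
    · rw [Algebra.smul_def, map_mul]
      change E (r : MvPowerSeries σ k) * _ = 0
      rw [hE, Ideal.Quotient.eq_zero_iff_mem.mpr (hpow r hr), zero_mul]
    · rw [map_add, ha, hb, add_zero]
  rw [map_sub, hE, sub_eq_zero] at h0
  exact h0

open IsLocalRing in
theorem algHom_ext_of_map_X {k σ B : Type*} [Field k] [Finite σ] [CommRing B] [IsLocalRing B]
    [Algebra k B] {F G : MvPowerSeries σ k →ₐ[k] AdicCompletion (maximalIdeal B) B} {y : σ → B}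
    (hy : ∀ i, y i ∈ maximalIdeal B) (hF : ∀ i, F (MvPowerSeries.X i) = algebraMap B _ (y i))
    (hG : ∀ i, G (MvPowerSeries.X i) = algebraMap B _ (y i)) : F = G := by
  ext1 f
  refine AdicCompletion.ext_evalₐ fun N => ?_
  rw [evalₐ_eq_of_map_X F hy hF, evalₐ_eq_of_map_X G hy hG]

/-! ### Iterated power series rings -/

section SumEquiv

open MvPowerSeries Finset

variable (σ τ R : Type*) [CommSemiring R]

/-- Currying of the coefficients of a power series. -/
def curryFun (f : MvPowerSeries (σ ⊕ τ) R) : MvPowerSeries σ (MvPowerSeries τ R) :=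
  fun a b => coeff (a.sumElim b) f

/-- The inverse of `curryFun`. -/
def uncurryFun (g : MvPowerSeries σ (MvPowerSeries τ R)) : MvPowerSeries (σ ⊕ τ) R :=
  fun c => coeff (c.comapDomain Sum.inr Sum.inr_injective.injOn)
    (coeff (c.comapDomain Sum.inl Sum.inl_injective.injOn) g)

variable {σ τ R}

theorem coeff_coeff_curryFun (f : MvPowerSeries (σ ⊕ τ) R) (a : σ →₀ ℕ) (b : τ →₀ ℕ) :
    coeff b (coeff a (curryFun σ τ R f)) = coeff (a.sumElim b) f := rfl

theorem coeff_uncurryFun (g : MvPowerSeries σ (MvPowerSeries τ R)) (c : σ ⊕ τ →₀ ℕ) :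
    coeff c (uncurryFun σ τ R g) =
      coeff (c.comapDomain Sum.inr Sum.inr_injective.injOn)
        (coeff (c.comapDomain Sum.inl Sum.inl_injective.injOn) g) := rfl

theorem ext_coeff_coeff {f g : MvPowerSeries σ (MvPowerSeries τ R)}
    (h : ∀ a b, coeff b (coeff a f) = coeff b (coeff a g)) : f = g :=
  MvPowerSeries.ext fun a => MvPowerSeries.ext fun b => h a b

theorem curryFun_mul (f g : MvPowerSeries (σ ⊕ τ) R) :
    curryFun σ τ R (f * g) = curryFun σ τ R f * curryFun σ τ R g := by
  classical
  refine ext_coeff_coeff fun a b => ?_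
  simp only [coeff_mul, map_sum, coeff_coeff_curryFun]
  rw [sum_sigma']
  refine sum_bij (fun c _ => ⟨(c.1.comapDomain Sum.inl Sum.inl_injective.injOn,
    c.2.comapDomain Sum.inl Sum.inl_injective.injOn),
    (c.1.comapDomain Sum.inr Sum.inr_injective.injOn,
    c.2.comapDomain Sum.inr Sum.inr_injective.injOn)⟩) ?_ ?_ ?_ ?_
  · rintro ⟨c, d⟩ h
    simp only [HasAntidiagonal.mem_antidiagonal, mem_sigma] at h ⊢
    constructor
    · ext i; simpa using DFunLike.congr_fun h (Sum.inl i)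
    · ext i; simpa using DFunLike.congr_fun h (Sum.inr i)
  · rintro ⟨c, d⟩ - ⟨c', d'⟩ - h
    simp only [Sigma.mk.injEq, Prod.mk.injEq, heq_eq_eq] at h
    obtain ⟨⟨h1, h2⟩, h3, h4⟩ := h
    rw [← Finsupp.comapDomain_sumElim_comapDomain c, ← Finsupp.comapDomain_sumElim_comapDomain d,
      h1, h2, h3, h4, Finsupp.comapDomain_sumElim_comapDomain,
      Finsupp.comapDomain_sumElim_comapDomain]
  · rintro ⟨⟨a1, a2⟩, ⟨b1, b2⟩⟩ h
    simp only [HasAntidiagonal.mem_antidiagonal, mem_sigma] at h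
    refine ⟨(a1.sumElim b1, a2.sumElim b2), ?_, ?_⟩
    · rw [HasAntidiagonal.mem_antidiagonal, ← Finsupp.sumElim_add, h.1, h.2]
    · simp [Finsupp.comapDomain_inl_sumElim, Finsupp.comapDomain_inr_sumElim]
  · rintro ⟨c, d⟩ -
    rw [Finsupp.comapDomain_sumElim_comapDomain, Finsupp.comapDomain_sumElim_comapDomain]

theorem sumElim_eq_sumElim_iff {a a' : σ →₀ ℕ} {b b' : τ →₀ ℕ} :
    a.sumElim b = a'.sumElim b' ↔ a = a' ∧ b = b' := by
  refine ⟨fun h => ⟨?_, ?_⟩, fun h => by rw [h.1, h.2]⟩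
  · rw [← Finsupp.comapDomain_inl_sumElim a b, h, Finsupp.comapDomain_inl_sumElim]
  · rw [← Finsupp.comapDomain_inr_sumElim a b, h, Finsupp.comapDomain_inr_sumElim]

theorem curryFun_algebraMap (r : R) :
    curryFun σ τ R (algebraMap R _ r) = algebraMap R _ r := by
  classical
  refine ext_coeff_coeff fun a b => ?_
  rw [coeff_coeff_curryFun, MvPowerSeries.algebraMap_apply, MvPowerSeries.algebraMap_apply,
    MvPowerSeries.algebraMap_apply, coeff_C, coeff_C, ← Finsupp.sumElim_zero_zero]
  simp only [sumElim_eq_sumElim_iff]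
  by_cases ha : a = 0 <;> by_cases hb : b = 0 <;> simp [ha, hb, coeff_C]

variable (σ τ R)

/-- Power series in the variables `σ ⊕ τ` are power series in the variables `σ` with coefficients
in the ring of power series in the variables `τ`. -/
def sumEquiv : MvPowerSeries (σ ⊕ τ) R ≃ₐ[R] MvPowerSeries σ (MvPowerSeries τ R) where
  toFun := curryFun σ τ R
  invFun := uncurryFun σ τ R
  left_inv f := MvPowerSeries.ext fun c => by
    rw [coeff_uncurryFun, coeff_coeff_curryFun, Finsupp.comapDomain_sumElim_comapDomain]
  right_inv g := ext_coeff_coeff fun a b => by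
    rw [coeff_coeff_curryFun, coeff_uncurryFun, Finsupp.comapDomain_inl_sumElim,
      Finsupp.comapDomain_inr_sumElim]
  map_add' f g := rfl
  map_mul' := curryFun_mul
  commutes' := curryFun_algebraMap

variable {σ τ R}

theorem coeff_coeff_sumEquiv (f : MvPowerSeries (σ ⊕ τ) R) (a : σ →₀ ℕ) (b : τ →₀ ℕ) :
    coeff b (coeff a (sumEquiv σ τ R f)) = coeff (a.sumElim b) f := rfl

theorem sumEquiv_X_inl (i : σ) : sumEquiv σ τ R (X (Sum.inl i)) = X i := by
  classical
  refine ext_coeff_coeff fun a b => ?_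
  rw [coeff_coeff_sumEquiv, coeff_X, coeff_X, ← Finsupp.sumElim_single_zero]
  simp only [sumElim_eq_sumElim_iff]
  by_cases ha : a = Finsupp.single i 1 <;> by_cases hb : b = 0 <;> simp [ha, hb, coeff_one]

end SumEquiv

/-! ### Setting a variable to zero, and vanishing derivatives in characteristic two -/

theorem ker_killCompl {σ τ R : Type*} [CommRing R] (e : σ ↪ τ) (t : τ)
    (he : Set.range e = {t}ᶜ) :
    RingHom.ker (MvPowerSeries.killCompl (R := R) e) = Ideal.span {MvPowerSeries.X t} := by
  ext f
  rw [Ideal.mem_span_singleton, MvPowerSeries.X_dvd_iff, RingHom.mem_ker]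
  constructor
  · intro h d hd
    have : d ∈ Set.range (Finsupp.embDomain e) := by
      rw [Finsupp.mem_range_embDomain_iff, he]
      intro s hs hst
      rw [Set.mem_singleton_iff] at hst
      subst hst
      exact (Finsupp.mem_support_iff.mp hs) hd
    obtain ⟨d, rfl⟩ := this
    rw [← MvPowerSeries.coeff_killCompl, h, map_zero]
  · intro h
    ext d
    rw [MvPowerSeries.coeff_killCompl, map_zero]
    apply h
    rw [Finsupp.embDomain_of_notMem_range]
    rw [he]; simp

theorem killCompl_surjective {σ τ R : Type*} [CommRing R] (e : σ ↪ τ) :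
    Function.Surjective (MvPowerSeries.killCompl (R := R) e) :=
  fun f => ⟨MvPowerSeries.rename e f, MvPowerSeries.killCompl_rename_app f⟩

/-- In characteristic two, a power series with vanishing derivative in a variable only involves
even powers of that variable. -/
theorem coeff_eq_zero_of_pderiv_eq_zero {σ R : Type*} [CommRing R] [CharP R 2] {i : σ}
    {f : MvPowerSeries σ R} (hf : MvPowerSeries.pderiv R i f = 0) {d : σ →₀ ℕ} (hd : Odd (d i)) :
    f.coeff d = 0 := by
  have hpos : 1 ≤ d i := hd.pos
  have h := MvPowerSeries.coeff_pderiv (R := R) (i := i) f (d - Finsupp.single i 1)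
  have e : d - Finsupp.single i 1 + Finsupp.single i 1 = d :=
    tsub_add_cancel_of_le (by simpa [Finsupp.single_le_iff] using hpos)
  rw [hf, map_zero, e] at h
  obtain ⟨r, hr⟩ := hd
  -- The derivative multiplies the coefficient at `d` by `(d i - 1) + 1`; as `d i - 1` is even, this
  -- factor is `1`.
  have h1 : (((d - Finsupp.single i 1 : σ →₀ ℕ) i : ℕ) : R) = 0 := by
    rw [Finsupp.tsub_apply, Finsupp.single_eq_same, hr, Nat.add_sub_cancel, Nat.cast_mul]
    rw [CharP.cast_eq_zero, zero_mul]
  rw [h1, zero_add, mul_one] at h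
  exact h.symm

/-! ### The image of `(γ^R)^*` -/

section GammaRange

open MvPowerSeries

variable (R : Type u) [CommRing R]

/-- The exponents of the monomials `x₁², x₁z, x₂², x₂z, x₁x₂z, z`. -/
def gammaExp : Fin 6 → (Fin 3 →₀ ℕ) :=
  ![Finsupp.single 0 2, Finsupp.single 0 1 + Finsupp.single 2 1, Finsupp.single 1 2,
    Finsupp.single 1 1 + Finsupp.single 2 1,
    Finsupp.single 0 1 + Finsupp.single 1 1 + Finsupp.single 2 1, Finsupp.single 2 1]

theorem gammaImage_eq_monomial (i : Fin 6) : gammaImage R i = monomial (gammaExp i) 1 := by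
  fin_cases i <;>
    simp [gammaImage, gammaExp, X_def, monomial_mul_monomial, monomial_pow]

theorem prod_gammaImage (d : Fin 6 →₀ ℕ) :
    (d.prod fun i e => gammaImage R i ^ e) = monomial (d.sum fun i e => e • gammaExp i) 1 := by
  rw [Finsupp.prod_fintype _ _ (by simp), Finsupp.sum_fintype _ _ (by simp)]
  simp only [gammaImage_eq_monomial, monomial_pow, one_pow]
  rw [prod_monomial, Finset.prod_const_one]

/-- A monomial in `u₁, v₁, u₂, v₂, w, y` lying over a given monomial in `x₁, x₂, z`. -/
def gammaSection (n : Fin 3 →₀ ℕ) : Fin 6 →₀ ℕ :=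
  -- The even parts of the exponents of `x₁, x₂` go to `u₁, u₂`. The odd remainder is absorbed by
  -- `v₁`, `v₂` or `w`, according to which of the two exponents are odd, at the cost of one `z`; the
  -- other factors `z` go to `y`.
  Finsupp.equivFunOnFinite.symm
    ![n 0 / 2, n 0 % 2 * (1 - n 1 % 2), n 1 / 2, n 1 % 2 * (1 - n 0 % 2), n 0 % 2 * (n 1 % 2),
      n 2 - (n 0 % 2 + n 1 % 2 - n 0 % 2 * (n 1 % 2))]

/-- The hypothesis makes the truncated subtraction in the exponent of `y` exact: a factor `z` is
spent only when `n 0` or `n 1` is odd. -/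
theorem sum_gammaSection {n : Fin 3 →₀ ℕ} (hn : n 2 = 0 → Even (n 0) ∧ Even (n 1)) :
    ((gammaSection n).sum fun i e => e • gammaExp i) = n := by
  rw [Finsupp.sum_fintype _ _ (by simp)]
  have h0 : n 0 % 2 = 0 ∨ n 0 % 2 = 1 := by omega
  have h1 : n 1 % 2 = 0 ∨ n 1 % 2 = 1 := by omega
  simp only [Nat.even_iff] at hn
  ext j
  fin_cases j <;> rcases h0 with h0 | h0 <;> rcases h1 with h1 | h1 <;>
    simp [Fin.sum_univ_succ, gammaSection, gammaExp, h0, h1] <;> omega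

/-- A preimage carries each coefficient of `f` on the single monomial selected by `gammaSection`, so
only one term contributes to each coefficient after substitution. -/
theorem mem_range_gammaHom {f : MvPowerSeries (Fin 3) R}
    (hf : ∀ n : Fin 3 →₀ ℕ, n 2 = 0 → ¬ (Even (n 0) ∧ Even (n 1)) → coeff n f = 0) :
    f ∈ (gammaHom R).range := by
  classical
  let g : MvPowerSeries (Fin 6) R := fun d =>
    if gammaSection (d.sum fun i e => e • gammaExp i) = d then
      coeff (d.sum fun i e => e • gammaExp i) f else 0
  have hg : ∀ d, coeff d g = if gammaSection (d.sum fun i e => e • gammaExp i) = d then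
      coeff (d.sum fun i e => e • gammaExp i) f else 0 := fun d => rfl
  refine ⟨g, ?_⟩
  ext n
  change coeff n (gammaHom R g) = _
  rw [gammaHom, substAlgHom_apply, coeff_subst (hasSubst_gammaImage R)]
  rw [finsum_eq_single _ (gammaSection n)]
  · rw [prod_gammaImage, hg]
    by_cases hn : n 2 = 0 → Even (n 0) ∧ Even (n 1)
    · rw [sum_gammaSection hn]; simp
    -- Here `gammaSection n` need not lie over `n`, but `f` has coefficient zero at `n`, so both
    -- sides vanish.
    · push Not at hn
      rw [hf n hn.1 (by tauto)]
      split_ifs with h1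
      · rw [coeff_monomial]
        split_ifs with h2
        · rw [← h2, hf n hn.1 (by tauto), zero_smul]
        · simp
      · simp
  · intro d hd
    rw [prod_gammaImage, hg, coeff_monomial]
    by_cases h : n = d.sum fun i e => e • gammaExp i
    · rw [if_neg, zero_smul]
      rw [← h]; exact fun h' => hd h'.symm
    · rw [if_neg h, smul_zero]

end GammaRange

/-! ### Differentials and the cotangent space at a rational point -/

section CotangentSpace

open IsLocalRing

variable {k O : Type*} [Field k] [CommRing O] [IsLocalRing O] [Algebra k O]

theorem eq_zero_of_algebraMap_mem {c : k} (hc : algebraMap k O c ∈ maximalIdeal O) : c = 0 := by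
  by_contra h
  exact (IsLocalRing.mem_maximalIdeal _).mp hc ((IsUnit.mk0 _ h).map (algebraMap k O))

/-- The value of a function at a `k`-rational point. -/
def evalPt (hres : ∀ a : O, ∃ c : k, a - algebraMap k O c ∈ maximalIdeal O) : O →ₐ[k] k :=
  have hs := fun a => (hres a).choose_spec
  have hu : ∀ (a : O) (c : k), a - algebraMap k O c ∈ maximalIdeal O → (hres a).choose = c :=
    fun a c hc => sub_eq_zero.mp <| eq_zero_of_algebraMap_mem (O := O) (by
      rw [map_sub]
      simpa using sub_mem hc (hs a))
  { toFun := fun a => (hres a).choose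
    map_one' := hu _ _ (by simp)
    map_zero' := hu _ _ (by simp)
    map_add' := fun a b => hu _ _ (by
      rw [map_add, add_sub_add_comm]; exact add_mem (hs a) (hs b))
    map_mul' := fun a b => hu _ _ (by
      have e : a * b - algebraMap k O ((hres a).choose * (hres b).choose) =
          a * (b - algebraMap k O (hres b).choose) +
            algebraMap k O (hres b).choose * (a - algebraMap k O (hres a).choose) := by
        rw [map_mul]; ring
      rw [e]
      exact add_mem (Ideal.mul_mem_left _ _ (hs b)) (Ideal.mul_mem_left _ _ (hs a)))
    commutes' := fun c => hu _ _ (by simp) }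

variable (hres : ∀ a : O, ∃ c : k, a - algebraMap k O c ∈ maximalIdeal O)

theorem sub_evalPt_mem (a : O) : a - algebraMap k O (evalPt hres a) ∈ maximalIdeal O :=
  (hres a).choose_spec

theorem evalPt_eq_zero_iff {a : O} : evalPt hres a = 0 ↔ a ∈ maximalIdeal O := by
  refine ⟨fun h => by simpa [h] using sub_evalPt_mem hres a, fun h => ?_⟩
  exact eq_zero_of_algebraMap_mem (O := O) (by simpa using sub_mem h (sub_evalPt_mem hres a))

theorem smul_cotangent (a : O) (β : CotangentSpace O) : a • β = evalPt hres a • β := by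
  rw [← algebraMap_smul O (evalPt hres a) β, ← sub_eq_zero, ← sub_smul]
  obtain ⟨t, rfl⟩ := Ideal.toCotangent_surjective _ β
  rw [← map_smul, Ideal.toCotangent_eq_zero, pow_two]
  exact Ideal.mul_mem_mul (sub_evalPt_mem hres a) t.2

/-- The universal derivation `a ↦ a - a(P)` into the cotangent space of a rational point. -/
def cotangentDerivation : Derivation k O (CotangentSpace O) :=
  Derivation.mk'
    { toFun := fun a => (maximalIdeal O).toCotangent ⟨_, sub_evalPt_mem hres a⟩
      map_add' := fun a b => by
        rw [← map_add, Ideal.toCotangent_eq]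
        simp [add_sub_add_comm]
      map_smul' := fun c a => by
        change _ = c • (maximalIdeal O).toCotangent ⟨_, sub_evalPt_mem hres a⟩
        rw [← algebraMap_smul O c ((maximalIdeal O).toCotangent _), ← map_smul,
          Ideal.toCotangent_eq]
        simp [Algebra.smul_def, mul_sub] }
    (fun a b => by
      change (maximalIdeal O).toCotangent _ =
        a • (maximalIdeal O).toCotangent _ + b • (maximalIdeal O).toCotangent _
      rw [← map_smul, ← map_smul, ← map_add, Ideal.toCotangent_eq]
      have e : a * b - algebraMap k O (evalPt hres (a * b)) -
          (a * (b - algebraMap k O (evalPt hres b)) + b * (a - algebraMap k O (evalPt hres a))) =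
          -((a - algebraMap k O (evalPt hres a)) * (b - algebraMap k O (evalPt hres b))) := by
        rw [map_mul, map_mul]; ring
      change a * b - algebraMap k O (evalPt hres (a * b)) -
          (a * (b - algebraMap k O (evalPt hres b)) + b * (a - algebraMap k O (evalPt hres a))) ∈ _
      rw [e, pow_two]
      exact neg_mem (Ideal.mul_mem_mul (sub_evalPt_mem hres a) (sub_evalPt_mem hres b)))

theorem cotangentDerivation_apply (a : O) : cotangentDerivation hres a =
    (maximalIdeal O).toCotangent ⟨_, sub_evalPt_mem hres a⟩ := rfl

theorem cotangentDerivation_of_mem {a : O} (ha : a ∈ maximalIdeal O) :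
    cotangentDerivation hres a = (maximalIdeal O).toCotangent ⟨a, ha⟩ := by
  rw [cotangentDerivation_apply]
  congr 2
  rw [(evalPt_eq_zero_iff hres).mpr ha, map_zero, sub_zero]

variable {A ι : Type*} [CommRing A] [Algebra k A] [Algebra A O] [IsScalarTower k A O] [Fintype ι]

/-- The cotangent space at a rational point in terms of a basis of differentials. -/
theorem exists_cotangent_generators (S : Submonoid A) [IsLocalization S O]
    (b : Module.Basis ι A (Ω[A⁄k])) :
    ∃ β : ι → CotangentSpace O, Submodule.span k (Set.range β) = ⊤ ∧
      ∀ a : A, cotangentDerivation hres (algebraMap A O a) =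
        ∑ i, evalPt hres (algebraMap A O (b.repr (KaehlerDifferential.D k A a) i)) • β i := by
  let b' : Module.Basis ι O (Ω[O⁄k]) :=
    b.ofIsLocalizedModule O S (KaehlerDifferential.map k k A O)
  let ℓ := (cotangentDerivation hres).liftKaehlerDifferential
  have h1 : ∀ a : O, cotangentDerivation hres a =
      ∑ i, evalPt hres (b'.repr (KaehlerDifferential.D k O a) i) • ℓ (b' i) := by
    intro a
    rw [← Derivation.liftKaehlerDifferential_comp_D (cotangentDerivation hres)]
    conv_lhs => rw [← b'.sum_repr (KaehlerDifferential.D k O a)]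
    rw [map_sum]
    refine Finset.sum_congr rfl fun i _ => ?_
    rw [map_smul, smul_cotangent hres]
  refine ⟨fun i => ℓ (b' i), ?_, fun a => ?_⟩
  · rw [eq_top_iff]
    rintro β -
    obtain ⟨t, rfl⟩ := Ideal.toCotangent_surjective _ β
    rw [← cotangentDerivation_of_mem hres t.2, h1]
    exact sum_mem fun i _ => Submodule.smul_mem _ _ (Submodule.subset_span ⟨i, rfl⟩)
  · rw [h1]
    refine Finset.sum_congr rfl fun i _ => ?_
    rw [← KaehlerDifferential.map_D k k A O, Module.Basis.ofIsLocalizedModule_repr_apply]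

/-- The matrix of derivatives of a family of functions with respect to a basis of differentials is
singular at a rational point where sufficiently many of these functions have vanishing differential
along a subspace of the tangent space. -/
theorem det_mem_of_two_le_finrank [DecidableEq ι] (S : Submonoid A) [IsLocalization S O]
    (b : Module.Basis ι A (Ω[A⁄k])) (K : Submodule k (Module.Dual k (CotangentSpace O)))
    [FiniteDimensional k K]
    (hK : 2 ≤ Module.finrank k K) (y : ι → A) (j₀ : ι)
    (hy : ∀ j, j ≠ j₀ → ∀ v ∈ K, v (cotangentDerivation hres (algebraMap A O (y j))) = 0) :
    algebraMap A O (Matrix.of fun i j => b.repr (KaehlerDifferential.D k A (y j)) i).det ∈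
      maximalIdeal O := by
  obtain ⟨β, hβ, hD⟩ := exists_cotangent_generators hres S b
  -- One linear condition on a space of dimension at least 2 has a nonzero solution.
  have h1 : ∃ v ∈ K, v ≠ 0 ∧ v (cotangentDerivation hres (algebraMap A O (y j₀))) = 0 := by
    let T : K →ₗ[k] k :=
      (Module.Dual.eval k _ (cotangentDerivation hres (algebraMap A O (y j₀)))).comp K.subtype
    have hT : T.ker ≠ ⊥ := by
      refine LinearMap.ker_ne_bot_of_finrank_lt (K := k) (V := K) (V₂ := k) ?_
      rw [Module.finrank_self]; omega
    obtain ⟨v, hv, hv0⟩ := Submodule.exists_mem_ne_zero_of_ne_bot hT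
    exact ⟨v, v.2, by simpa using hv0, hv⟩
  obtain ⟨v, hvK, hv0, hv⟩ := h1
  have h2 : ∀ j, v (cotangentDerivation hres (algebraMap A O (y j))) = 0 := fun j => by
    by_cases hj : j = j₀
    · rw [hj, hv]
    · exact hy j hj v hvK
  rw [← evalPt_eq_zero_iff hres]
  change ((evalPt hres).toRingHom.comp (algebraMap A O)) _ = 0
  rw [RingHom.map_det, ← Matrix.exists_vecMul_eq_zero_iff]
  -- The values of `v` on the generators `β` form a row vector annihilating the matrix at the point;
  -- it is nonzero because the `β i` span.
  refine ⟨fun i => v (β i), fun h => hv0 ?_, ?_⟩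
  · have : v = (0 : CotangentSpace O →ₗ[k] k) :=
      LinearMap.ext_on_range hβ fun i => congrFun h i
    exact this
  · ext j
    rw [Pi.zero_apply, ← h2 j, hD, map_sum]
    simp only [Matrix.vecMul, dotProduct, map_smul, smul_eq_mul]
    exact Finset.sum_congr rfl fun i _ => mul_comm _ _

end CotangentSpace

/-! ### The dimension of the cotangent space -/

section Rank

open IsLocalRing TensorProduct

theorem finrank_cotangent_of_eq {k O : Type*} [Field k] [CommRing O] [Algebra k O]
    {I J : Ideal O} (h : I = J) : Module.finrank k I.Cotangent = Module.finrank k J.Cotangent := by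
  rw [h]

/-- The dimension of the cotangent space of a formally smooth local algebra at a rational point. -/
theorem finrank_cotangentSpace {k O : Type u} [Field k] [CommRing O] [IsLocalRing O] [Algebra k O]
    [Algebra.FormallySmooth k O]
    (hres : ∀ a : O, ∃ c : k, a - algebraMap k O c ∈ maximalIdeal O)
    {ι : Type*} [Fintype ι] (b : Module.Basis ι O (Ω[O⁄k])) :
    Module.finrank k (CotangentSpace O) = Fintype.card ι := by
  have hbij : Function.Bijective (algebraMap k (ResidueField O)) := by
    refine ⟨(algebraMap k (ResidueField O)).injective, fun a => ?_⟩
    obtain ⟨a, rfl⟩ := IsLocalRing.residue_surjective a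
    refine ⟨evalPt hres a, ?_⟩
    rw [IsScalarTower.algebraMap_apply k O (ResidueField O), ResidueField.algebraMap_eq]
    exact (Ideal.Quotient.eq.mpr (sub_evalPt_mem hres a)).symm
  let e : k ≃ₐ[k] ResidueField O := AlgEquiv.ofBijective (Algebra.ofId _ _) hbij
  -- The residue field is `k`, hence formally smooth with no differentials. These two facts give
  -- injectivity and surjectivity of `𝔪 / 𝔪² → κ ⊗ Ω` in the conormal sequence.
  have hsm : Algebra.FormallySmooth k (ResidueField O) := Algebra.FormallySmooth.of_equiv e
  have hsurj : Function.Surjective (algebraMap O (ResidueField O)) :=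
    IsLocalRing.residue_surjective
  have hinj : Function.Injective (KaehlerDifferential.kerCotangentToTensor k O (ResidueField O)) :=
    (Algebra.FormallySmooth.kerCotangentToTensor_injective_iff hsurj).mpr inferInstance
  have hΩ : Subsingleton (Ω[ResidueField O⁄k]) := by
    have : Function.Surjective (algebraMap k (ResidueField O)) := hbij.2
    exact KaehlerDifferential.subsingleton_of_surjective _ _ this
  have hsur : Function.Surjective
      (KaehlerDifferential.kerCotangentToTensor k O (ResidueField O)) := fun t =>
    (KaehlerDifferential.exact_kerCotangentToTensor_mapBaseChange k O (ResidueField O) hsurj t).mp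
      (Subsingleton.elim _ _)
  let E := (LinearEquiv.ofBijective _ ⟨hinj, hsur⟩).restrictScalars k
  have h1 : RingHom.ker (algebraMap O (ResidueField O)) = maximalIdeal O := ker_residue
  have h2 : Module.finrank k (ResidueField O ⊗[O] Ω[O⁄k]) = Fintype.card ι := by
    have b2 : Module.Basis ι (ResidueField O) (ResidueField O ⊗[O] Ω[O⁄k]) := b.baseChange _
    have h3 := Module.finrank_eq_card_basis b2
    have h4 := Module.finrank_mul_finrank k (ResidueField O) (ResidueField O ⊗[O] Ω[O⁄k])
    rw [← e.toLinearEquiv.finrank_eq, Module.finrank_self, one_mul, h3] at h4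
    exact h4.symm
  rw [← h2, ← E.finrank_eq]
  exact (finrank_cotangent_of_eq h1).symm

end Rank

/-! ### The Jacobian criterion for a vanishing formal derivative -/

section Jacobian

open MvPowerSeries

/-- If the differential of `g` is a combination of the differentials of the coordinates other than
`x a`, as witnessed by a nilpotent Jacobian determinant, then `g` has vanishing formal derivative
with respect to the `a`-th coordinate. -/
theorem pderiv_eq_zero_of_isNilpotent_det {k A σ : Type*} [Field k] [CommRing A] [Algebra k A]
    [Fintype σ] [DecidableEq σ] (θ : A →ₐ[k] MvPowerSeries σ k) (x : σ → A)
    (hx : ∀ i, θ (x i) = X i) (b : Module.Basis σ A (Ω[A⁄k])) (g : A) (a : σ)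
    (hdet : IsNilpotent (Matrix.of fun i j =>
      b.repr (KaehlerDifferential.D k A (Function.update x a g j)) i).det) :
    pderiv k a (θ g) = 0 := by
  let : Algebra A (MvPowerSeries σ k) := θ.toAlgebra
  have : IsScalarTower k A (MvPowerSeries σ k) := IsScalarTower.of_algHom θ
  let dX : σ → Derivation k A (MvPowerSeries σ k) := fun c => (pderiv k c).compAlgebraMap A
  have hΓ : ∀ c f, pderiv k c (θ f) =
      ∑ i, (dX c).liftKaehlerDifferential (b i) *
        θ (b.repr (KaehlerDifferential.D k A f) i) := by
    intro c f
    change dX c f = _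
    rw [← Derivation.liftKaehlerDifferential_comp_D (dX c)]
    conv_lhs => rw [← b.sum_repr (KaehlerDifferential.D k A f)]
    rw [map_sum]
    refine Finset.sum_congr rfl fun i _ => ?_
    rw [map_smul, Algebra.smul_def, mul_comm]
    rfl
  let Γ : Matrix σ σ (MvPowerSeries σ k) :=
    Matrix.of fun c i => (dX c).liftKaehlerDifferential (b i)
  let M : Matrix σ σ (MvPowerSeries σ k) :=
    Matrix.of fun i j => θ (b.repr (KaehlerDifferential.D k A (x j)) i)
  let w : σ → MvPowerSeries σ k := fun i => θ (b.repr (KaehlerDifferential.D k A g) i)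
  -- The chain rule: the formal derivatives of the coordinates form the identity matrix.
  have h1 : Γ * M = 1 := by
    ext1 c j
    rw [Matrix.mul_apply, Matrix.one_apply]
    change ∑ i, (dX c).liftKaehlerDifferential (b i) * θ _ = _
    rw [← hΓ, hx, pderiv_X, Pi.single_apply]
    simp only [eq_comm]
  have h2 : pderiv k a (θ g) = Γ.mulVec w a := hΓ a g
  have h3 : M.det ≠ 0 := by
    intro h
    have := congrArg Matrix.det h1
    rw [Matrix.det_mul, h, mul_zero, Matrix.det_one] at this
    exact zero_ne_one this
  -- This Cramer entry is the image of the determinant in `hdet`; it is nilpotent in a domain, hence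
  -- zero.
  have h4 : M.cramer w a = 0 := by
    rw [Matrix.cramer_apply]
    have h5 := hdet.map θ.toRingHom
    have h6 := h5.eq_zero
    rw [RingHom.map_det] at h6
    rw [← h6]
    congr 1
    ext1 i j
    by_cases hj : j = a
    · subst hj
      simp [M, w]
    · simp [M, w, hj]
  -- As `M` times its Cramer vector is `det M` times `w`, entry `a` reads `det M · ∂(θ g)/∂x_a = 0`.
  have h5 : Γ.mulVec (M.mulVec (M.cramer w)) = M.cramer w := by
    rw [Matrix.mulVec_mulVec, h1, Matrix.one_mulVec]
  rw [Matrix.mulVec_cramer, Matrix.mulVec_smul] at h5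
  have h6 := congrFun h5 a
  rw [h4, Pi.smul_apply, smul_eq_mul, ← h2] at h6
  exact (mul_eq_zero.mp h6).resolve_left h3

end Jacobian

/-- The Nullstellensatz: `A` is a Jacobson ring, so its nilradical is the intersection of its
maximal ideals. -/
theorem isNilpotent_of_forall_mem_isMaximal {k A : Type*} [Field k] [CommRing A] [Algebra k A]
    [Algebra.FiniteType k A] {a : A} (h : ∀ q : Ideal A, q.IsMaximal → a ∈ q) :
    IsNilpotent a := by
  have hJ : IsJacobsonRing A := isJacobsonRing_of_finiteType (A := k)
  rw [← mem_nilradical, nilradical, Ideal.radical_eq_jacobson, Ideal.jacobson, Ideal.mem_sInf]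
  exact fun {q} hq => h q hq.2

/-! ### Smooth charts and local rings at closed points -/

section Charts

variable {k : Type u} [Field k]

/-- The sections of a `k`-scheme over an open set are a `k`-algebra. -/
instance sectionAlgebra (X : Over (Spec (.of k))) (U : X.left.Opens) : Algebra k Γ(X.left, U) :=
  ((X.hom.appLE ⊤ U le_top).hom.comp (Scheme.ΓSpecIso (.of k)).inv.hom).toAlgebra

theorem germ_algebraMap (X : Over (Spec (.of k))) (U : X.left.Opens) (x : X.left) (hx : x ∈ U)
    (c : k) : X.left.presheaf.germ U x hx (algebraMap k Γ(X.left, U) c) =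
      algebraMap k (X.left.presheaf.stalk x) c := by
  have h : X.hom.appLE ⊤ U le_top ≫ X.left.presheaf.germ U x hx =
      X.hom.appTop ≫ X.left.presheaf.germ ⊤ x trivial := by
    change (_ ≫ _) ≫ _ = _
    rw [Category.assoc, TopCat.Presheaf.germ_res]
    rfl
  exact congrArg (fun f => f.hom ((Scheme.ΓSpecIso (.of k)).inv c)) h

theorem fromSpecStalk_comp_hom (X : Over (Spec (.of k))) (x : X.left) :
    X.left.fromSpecStalk x ≫ X.hom =
      Spec.map (CommRingCat.ofHom (algebraMap k (X.left.presheaf.stalk x))) := by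
  rw [← cancel_mono (Spec (.of k)).toSpecΓ, Category.assoc, Scheme.toSpecΓ_naturality,
    Scheme.fromSpecStalk_toSpecΓ_assoc, ← SpecMap_ΓSpecIso_hom, ← Spec.map_comp, ← Spec.map_comp]
  congr 1
  rw [← Iso.inv_comp_eq]
  rfl

/-- The residue field at a closed point is `k`; what needs checking is that this identification
agrees with the algebra structure on the stalk. -/
theorem exists_sub_algebraMap_mem [IsAlgClosed k] (X : Over (Spec (.of k)))
    [LocallyOfFiniteType X.hom] (x : X.left) (hx : IsClosed {x}) (a : X.left.presheaf.stalk x) :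
    ∃ c : k, a - algebraMap k _ c ∈ IsLocalRing.maximalIdeal (X.left.presheaf.stalk x) := by
  have h : (residueFieldIsoBase X.hom x hx).inv =
      CommRingCat.ofHom (algebraMap k (X.left.presheaf.stalk x)) ≫ X.left.residue x := by
    apply Spec.map_injective
    rw [SpecMap_residueFieldIsoBase_inv, Spec.map_comp, ← fromSpecStalk_comp_hom]
    rfl
  refine ⟨(residueFieldIsoBase X.hom x hx).hom (X.left.residue x a), ?_⟩
  rw [← IsLocalRing.residue_eq_zero_iff, map_sub, sub_eq_zero]
  have h2 := congrArg (fun f => f.hom ((residueFieldIsoBase X.hom x hx).hom (X.left.residue x a))) h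
  refine Eq.trans ?_ h2
  exact (Iso.hom_inv_id_apply (residueFieldIsoBase X.hom x hx) _).symm

theorem exists_isStandardSmooth_section (X : Over (Spec (.of k))) (n : ℕ)
    [SmoothOfRelativeDimension n X.hom] (x : X.left) (U₀ : X.left.Opens) (hx : x ∈ U₀) :
    ∃ U ≤ U₀, IsAffineOpen U ∧ x ∈ U ∧
      Algebra.IsStandardSmoothOfRelativeDimension n k Γ(X.left, U) := by
  obtain ⟨U', hU', V, hV, hxV, e, hf⟩ :=
    SmoothOfRelativeDimension.exists_isStandardSmoothOfRelativeDimension (n := n) (f := X.hom) x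
  -- `Spec k` has a single point, so the open subset of the base is all of it.
  have hU : U' = ⊤ := by
    rw [eq_top_iff]
    rintro y -
    rw [Subsingleton.elim y (X.hom x)]
    exact e hxV
  subst hU
  obtain ⟨f, hf1, hf2⟩ := hV.exists_basicOpen_le ⟨x, hx⟩ hxV
  refine ⟨X.left.basicOpen f, hf1, hV.basicOpen f, hf2, ?_⟩
  have := hV.isLocalization_basicOpen f
  have h1 := (RingHom.isStandardSmoothOfRelativeDimension_stableUnderCompositionWithLocalizationAway
    n).right Γ(X.left, X.left.basicOpen f) f _ hf
  have h2 := h1.comp (RingHom.IsStandardSmoothOfRelativeDimension.equiv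
    (Scheme.ΓSpecIso (.of k)).symm.commRingCatIsoToRingEquiv)
  have h3 : (algebraMap Γ(X.left, V) Γ(X.left, X.left.basicOpen f)).comp
      (X.hom.appLE ⊤ V e).hom = (X.hom.appLE ⊤ (X.left.basicOpen f) le_top).hom := by
    rw [← Scheme.Hom.appLE_map X.hom e (homOfLE (X.left.basicOpen_le f)).op]
    rfl
  rw [h3] at h2
  exact h2

section Stalk

variable {X : Over (Spec (.of k))} {U : X.left.Opens} (x : U)

instance isScalarTower_section_stalk :
    IsScalarTower k Γ(X.left, U) (X.left.presheaf.stalk x.1) :=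
  IsScalarTower.of_algebraMap_eq fun c => (germ_algebraMap X U x.1 x.2 c).symm

theorem formallySmooth_stalk [Algebra.FormallySmooth k Γ(X.left, U)] (hU : IsAffineOpen U) :
    Algebra.FormallySmooth k (X.left.presheaf.stalk x.1) := by
  have := hU.isLocalization_stalk x
  have := Algebra.FormallySmooth.of_isLocalization (hU.primeIdealOf x).asIdeal.primeCompl
    (R := Γ(X.left, U)) (Rₘ := X.left.presheaf.stalk x.1)
  exact Algebra.FormallySmooth.comp k Γ(X.left, U) _

theorem isNoetherianRing_stalk [Algebra.FiniteType k Γ(X.left, U)] (hU : IsAffineOpen U) :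
    IsNoetherianRing (X.left.presheaf.stalk x.1) := by
  have := hU.isLocalization_stalk x
  have : IsNoetherianRing Γ(X.left, U) := Algebra.FiniteType.isNoetherianRing k _
  exact IsLocalization.isNoetherianRing (hU.primeIdealOf x).asIdeal.primeCompl _ this

end Stalk

/-- A basis of the module of differentials of a standard smooth algebra. -/
def differentialBasis {A : Type u} [CommRing A] [Nontrivial A] [Algebra k A] (n : ℕ)
    (h : Algebra.IsStandardSmoothOfRelativeDimension n k A) {σ : Type*} [Fintype σ]
    (hσ : Fintype.card σ = n) : Module.Basis σ A (Ω[A⁄k]) :=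
  have := h.isStandardSmooth
  have : Module.Free A (Ω[A⁄k]) := inferInstance
  have : Module.Finite A (Ω[A⁄k]) := inferInstance
  (Module.finBasisOfFinrankEq A (Ω[A⁄k]) (by
    rw [Module.finrank, Algebra.IsStandardSmoothOfRelativeDimension.rank_kaehlerDifferential n,
      Cardinal.toNat_natCast])).reindex (Fintype.equivFinOfCardEq hσ).symm

/-- The local ring of a smooth scheme at a closed point. -/
theorem smooth_stalk [IsAlgClosed k] (X : Over (Spec (.of k))) (n : ℕ)
    (hX : SmoothOfRelativeDimension n X.hom) (x : X.left) (hx : IsClosed {x}) :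
    Algebra.FormallySmooth k (X.left.presheaf.stalk x) ∧
    IsNoetherianRing (X.left.presheaf.stalk x) ∧
    Module.finrank k (IsLocalRing.CotangentSpace (X.left.presheaf.stalk x)) = n := by
  obtain ⟨U, -, hU, hxU, h⟩ := exists_isStandardSmooth_section X n x ⊤ trivial
  have hsm := h.isStandardSmooth
  have h1 : Algebra.FormallySmooth k (X.left.presheaf.stalk x) :=
    formallySmooth_stalk (⟨x, hxU⟩ : U) hU
  have h2 : IsNoetherianRing (X.left.presheaf.stalk x) :=
    isNoetherianRing_stalk (⟨x, hxU⟩ : U) hU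
  have : Smooth X.hom := SmoothOfRelativeDimension.smooth n X.hom
  let : Algebra Γ(X.left, U) (X.left.presheaf.stalk x) :=
    X.left.presheaf.algebra_section_stalk ⟨x, hxU⟩
  have : IsScalarTower k Γ(X.left, U) (X.left.presheaf.stalk x) :=
    isScalarTower_section_stalk ⟨x, hxU⟩
  have := hU.isLocalization_stalk ⟨x, hxU⟩
  have : Nontrivial Γ(X.left, U) := (X.left.presheaf.germ U x hxU).hom.domain_nontrivial
  refine ⟨h1, h2, ?_⟩
  have h3 := finrank_cotangentSpace (exists_sub_algebraMap_mem X x hx)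
    ((differentialBasis n h (Fintype.card_fin n)).ofIsLocalizedModule
      (X.left.presheaf.stalk x) (hU.primeIdealOf ⟨x, hxU⟩).asIdeal.primeCompl
      (KaehlerDifferential.map k k Γ(X.left, U) (X.left.presheaf.stalk x)))
  rwa [Fintype.card_fin] at h3

end Charts

/-! ### Functions pulled back from `W`, near a point of `H` -/

section Germs

open IsLocalRing

variable {k : Type u} [Field k]

theorem isClosed_singleton_fromSpec (X : Over (Spec (.of k))) [LocallyOfFiniteType X.hom]
    {U : X.left.Opens} (hU : IsAffineOpen U) (q : PrimeSpectrum Γ(X.left, U))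
    (hq : q.asIdeal.IsMaximal) : IsClosed {hU.fromSpec q} := by
  have : JacobsonSpace X.left := LocallyOfFiniteType.jacobsonSpace X.hom
  have h : q ∈ closedPoints (PrimeSpectrum Γ(X.left, U)) :=
    (PrimeSpectrum.isClosed_singleton_iff_isMaximal q).mpr hq
  have h2 := hU.fromSpec.isOpenEmbedding.preimage_closedPoints
  exact (Set.ext_iff.mp h2 q).mpr h

variable {V W H : Over (Spec (.of k))} (φ : V ⟶ W) (i : H ⟶ V)

/-- The tangent vectors of `H` that are killed by the differential of `φ`. -/
def tangentKernel (Q : H.left) : Submodule k (TangentSpace H Q) :=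
  (LinearMap.ker (tangentMap φ (i.left Q))).comap (tangentMap i Q)

/-- After subtracting the value of `f` at the point, this pairs the cotangent class of `f` with the
image of `v` under the differential of `φ ∘ i`, which is zero. -/
theorem apply_cotangentDerivation_stalkPullback (Q : H.left)
    (hres : ∀ a : H.left.presheaf.stalk Q, ∃ c : k, a - algebraMap k _ c ∈
      maximalIdeal (H.left.presheaf.stalk Q))
    {v : TangentSpace H Q} (hv : v ∈ tangentKernel φ i Q)
    (f : W.left.presheaf.stalk (φ.left (i.left Q))) :
    v (cotangentDerivation hres (stalkPullback i Q (stalkPullback φ (i.left Q) f))) = 0 := by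
  set c := evalPt hres (stalkPullback i Q (stalkPullback φ (i.left Q) f)) with hc
  have hf : f - algebraMap k _ c ∈ maximalIdeal (W.left.presheaf.stalk (φ.left (i.left Q))) := by
    intro hu
    have h1 := (hu.map (stalkPullback φ (i.left Q))).map (stalkPullback i Q)
    rw [map_sub, map_sub, AlgHom.commutes, AlgHom.commutes] at h1
    exact sub_evalPt_mem hres _ h1
  have h2 : tangentMap φ (i.left Q) (tangentMap i Q v) = 0 := hv
  have h3 := LinearMap.congr_fun h2 (Ideal.toCotangent _ ⟨_, hf⟩)
  refine Eq.trans ?_ h3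
  rw [cotangentDerivation_apply]
  refine congrArg v (congrArg (Ideal.toCotangent _) (Subtype.ext ?_))
  change _ = stalkPullback i Q (stalkPullback φ (i.left Q) (f - algebraMap k _ c))
  rw [map_sub, map_sub, AlgHom.commutes, AlgHom.commutes]

/-- A section of `H` whose differential vanishes on `tangentKernel φ i` at every closed point. -/
def IsKilled [IsAlgClosed k] [LocallyOfFiniteType H.hom] (U : H.left.Opens)
    (s : Γ(H.left, U)) : Prop :=
  ∀ (Q : H.left) (hQ : IsClosed {Q}) (hQU : Q ∈ U), ∀ v ∈ tangentKernel φ i Q,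
    v (cotangentDerivation (exists_sub_algebraMap_mem H Q hQ)
      (H.left.presheaf.germ U Q hQU s)) = 0

theorem IsKilled.map [IsAlgClosed k] [LocallyOfFiniteType H.hom] {U U' : H.left.Opens}
    {s : Γ(H.left, U)} (hs : IsKilled φ i U s) (h : U' ≤ U) :
    IsKilled φ i U' (H.left.presheaf.map (homOfLE h).op s) := by
  intro Q hQ hQU v hv
  rw [TopCat.Presheaf.germ_res_apply]
  exact hs Q hQ (h hQU) v hv

/-- A germ on `W` extends to a neighbourhood, and its pull-back is killed at every closed point
there, not only at `P`. -/
theorem exists_isKilled [IsAlgClosed k] [LocallyOfFiniteType H.hom] (P : H.left)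
    (f : W.left.presheaf.stalk (φ.left (i.left P))) :
    ∃ (U : H.left.Opens) (hP : P ∈ U) (s : Γ(H.left, U)), H.left.presheaf.germ U P hP s =
      stalkPullback i P (stalkPullback φ (i.left P) f) ∧ IsKilled φ i U s := by
  obtain ⟨U, hU, t, rfl⟩ := W.left.presheaf.exists_germ_eq f
  have key : ∀ (Q : H.left) (hQ : φ.left (i.left Q) ∈ U),
      H.left.presheaf.germ (i.left ⁻¹ᵁ φ.left ⁻¹ᵁ U) Q hQ
        (i.left.app _ (φ.left.app U t)) =
      stalkPullback i Q (stalkPullback φ (i.left Q) (W.left.presheaf.germ U _ hQ t)) := by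
    intro Q hQ
    have h1 : stalkPullback φ (i.left Q) (W.left.presheaf.germ U _ hQ t) =
      V.left.presheaf.germ (φ.left ⁻¹ᵁ U) _ hQ (φ.left.app U t) :=
      φ.left.germ_stalkMap_apply U _ hQ t
    rw [h1]
    exact (i.left.germ_stalkMap_apply (φ.left ⁻¹ᵁ U) Q hQ _).symm
  refine ⟨i.left ⁻¹ᵁ φ.left ⁻¹ᵁ U, hU, i.left.app _ (φ.left.app U t), key P hU, ?_⟩
  intro Q hQ hQU v hv
  rw [key Q hQU]
  exact apply_cotangentDerivation_stalkPullback φ i Q _ hv _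

/-- A function pulled back along `φ` has vanishing formal derivatives along coordinate directions
of `H` lying in the kernel of the differential of `φ`. -/
theorem pderiv_stalkPullback_eq_zero [IsAlgClosed k] (n : ℕ)
    (hH : SmoothOfRelativeDimension n H.hom)
    (hK : ∀ Q : H.left, IsClosed {Q} → 2 ≤ Module.finrank k (tangentKernel φ i Q))
    (P : H.left) {σ : Type*} [Fintype σ] [DecidableEq σ] (hσ : Fintype.card σ = n)
    (θ : H.left.presheaf.stalk P →ₐ[k] MvPowerSeries σ k) (ξ : σ → H.left.presheaf.stalk P)
    (hξ : ∀ j, θ (ξ j) = MvPowerSeries.X j) (a a' : σ)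
    (hpull : ∀ j, j ≠ a → j ≠ a' → ∃ f, ξ j = stalkPullback i P (stalkPullback φ (i.left P) f))
    (g : W.left.presheaf.stalk (φ.left (i.left P))) :
    MvPowerSeries.pderiv k a (θ (stalkPullback i P (stalkPullback φ (i.left P) g))) = 0 := by
  have : Smooth H.hom := SmoothOfRelativeDimension.smooth n H.hom
  have h1 : ∀ j, ∃ (U : H.left.Opens) (hP : P ∈ U) (s : Γ(H.left, U)),
      H.left.presheaf.germ U P hP s = ξ j ∧ (j ≠ a → j ≠ a' → IsKilled φ i U s) := by
    intro j
    by_cases hj : j ≠ a ∧ j ≠ a'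
    · obtain ⟨f, hf⟩ := hpull j hj.1 hj.2
      obtain ⟨U, hP, s, hs, hs'⟩ := exists_isKilled φ i P f
      exact ⟨U, hP, s, hs.trans hf.symm, fun _ _ => hs'⟩
    · obtain ⟨U, hP, s, hs⟩ := H.left.presheaf.exists_germ_eq (ξ j)
      exact ⟨U, hP, s, hs, fun ha ha' => absurd ⟨ha, ha'⟩ hj⟩
  choose U hPU s hs hsK using h1
  obtain ⟨Ug, hPg, t, ht, htK⟩ := exists_isKilled φ i P g
  obtain ⟨U₁, hU₁, hU₁aff, hPU₁, hsm⟩ := exists_isStandardSmooth_section H n P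
    (Ug ⊓ Finset.univ.inf U) (by
      refine ⟨hPg, ?_⟩
      rw [TopologicalSpace.Opens.coe_finset_inf]
      simpa using hPU)
  have hg : U₁ ≤ Ug := hU₁.trans inf_le_left
  have hj : ∀ j, U₁ ≤ U j := fun j => (hU₁.trans inf_le_right).trans (Finset.inf_le (by simp))
  have := hsm.isStandardSmooth
  have : Nontrivial Γ(H.left, U₁) := (H.left.presheaf.germ U₁ P hPU₁).hom.domain_nontrivial
  let germP : Γ(H.left, U₁) →ₐ[k] H.left.presheaf.stalk P :=
    { (H.left.presheaf.germ U₁ P hPU₁).hom with commutes' := germ_algebraMap H U₁ P hPU₁ }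
  let x : σ → Γ(H.left, U₁) := fun j => H.left.presheaf.map (homOfLE (hj j)).op (s j)
  let t' : Γ(H.left, U₁) := H.left.presheaf.map (homOfLE hg).op t
  have hx : ∀ j, germP (x j) = ξ j := fun j =>
    (H.left.presheaf.germ_res_apply (homOfLE (hj j)) P hPU₁ (s j)).trans (hs j)
  have ht' : germP t' = stalkPullback i P (stalkPullback φ (i.left P) g) :=
    (H.left.presheaf.germ_res_apply (homOfLE hg) P hPU₁ t).trans ht
  rw [← ht']
  let b := differentialBasis n hsm hσ
  refine pderiv_eq_zero_of_isNilpotent_det (θ.comp germP) x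
    (fun j => (congrArg θ (hx j)).trans (hξ j)) b t' a ?_
  refine isNilpotent_of_forall_mem_isMaximal (k := k) fun q hq => ?_
  let q' : PrimeSpectrum Γ(H.left, U₁) := ⟨q, hq.isPrime⟩
  have hQcl := isClosed_singleton_fromSpec H hU₁aff q' hq
  have hQU : hU₁aff.fromSpec q' ∈ U₁ := hU₁aff.opensRange_fromSpec.le ⟨q', rfl⟩
  let : Algebra Γ(H.left, U₁) (H.left.presheaf.stalk (hU₁aff.fromSpec q')) :=
    H.left.presheaf.algebra_section_stalk ⟨hU₁aff.fromSpec q', hQU⟩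
  have : IsScalarTower k Γ(H.left, U₁) (H.left.presheaf.stalk (hU₁aff.fromSpec q')) :=
    isScalarTower_section_stalk ⟨hU₁aff.fromSpec q', hQU⟩
  have hloc : IsLocalization.AtPrime (H.left.presheaf.stalk (hU₁aff.fromSpec q')) q :=
    hU₁aff.isLocalization_stalk' q' hQU
  have hfin : FiniteDimensional k (tangentKernel φ i (hU₁aff.fromSpec q')) :=
    -- An infinite-dimensional space would have `finrank` equal to 0.
    FiniteDimensional.of_finrank_pos (by have := hK _ hQcl; omega)
  -- Column `a` holds the pulled-back function, and every other column except `a'` is a pulled-back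
  -- coordinate; `a'` is the one column allowed to be arbitrary.
  refine (IsLocalization.AtPrime.to_map_mem_maximal_iff _ q _).mp
    (det_mem_of_two_le_finrank (exists_sub_algebraMap_mem H _ hQcl) q.primeCompl b
      (tangentKernel φ i (hU₁aff.fromSpec q')) (hK _ hQcl) (Function.update x a t') a' ?_)
  intro j hja' v hv
  by_cases hja : j = a
  · subst hja
    rw [Function.update_self]
    exact htK.map φ i hg _ hQcl hQU v hv
  · rw [Function.update_of_ne hja]
    exact (hsK j hja hja').map φ i (hj j) _ hQcl hQU v hv

end Germs

/-! ### Coordinates adapted to `H` and `φ` -/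

section Coordinates

open IsLocalRing

/-- By the dimension count the classes form a basis of `𝔪 / 𝔪²`, and Nakayama's lemma gives
generators of `𝔪`. -/
theorem isCoordinateSystem_of_indep {k σ O : Type*} [Field k] [Fintype σ] [Nonempty σ]
    [CommRing O] [IsLocalRing O] [IsNoetherianRing O] [Algebra k O] {x : σ → O}
    (hres : ∀ a : O, ∃ c : k, a - algebraMap k O c ∈ maximalIdeal O)
    (hx : ∀ i, x i ∈ maximalIdeal O)
    (hcard : Module.finrank k (CotangentSpace O) = Fintype.card σ)
    (hindep : ∀ c : σ → k, ∑ i, c i • x i ∈ maximalIdeal O ^ 2 → c = 0) :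
    IsCoordinateSystem k x where
  residue := hres
  indep := hindep
  span_eq := by
    let y : σ → maximalIdeal O := fun i => ⟨x i, hx i⟩
    have hsum : ∀ c : σ → k, ∑ i, c i • (maximalIdeal O).toCotangent (y i) =
        (maximalIdeal O).toCotangent (∑ i, c i • y i) := fun c => by
      rw [map_sum]
      exact Finset.sum_congr rfl fun i _ =>
        (((maximalIdeal O).toCotangent.restrictScalars k).map_smul (c i) (y i)).symm
    have hli : LinearIndependent k fun i => (maximalIdeal O).toCotangent (y i) := by
      rw [Fintype.linearIndependent_iff]
      intro c hc
      rw [hsum, Ideal.toCotangent_eq_zero] at hc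
      refine congrFun (hindep c ?_)
      convert hc
      simp [y]
    have hspan : Submodule.span k (Set.range fun i => (maximalIdeal O).toCotangent (y i)) = ⊤ :=
      hli.span_eq_top_of_card_eq_finrank hcard.symm
    have hspan2 : Submodule.span (ResidueField O) ((maximalIdeal O).toCotangent '' Set.range y) =
        ⊤ := by
      rw [eq_top_iff]
      rintro t -
      have ht : t ∈ Submodule.span k (Set.range fun i => (maximalIdeal O).toCotangent (y i)) :=
        hspan ▸ Submodule.mem_top
      rw [← Set.range_comp]
      have : IsScalarTower k (ResidueField O) (CotangentSpace O) :=
        IsScalarTower.of_algebraMap_smul fun r t => by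
          rw [IsScalarTower.algebraMap_apply k O (ResidueField O), algebraMap_smul,
            algebraMap_smul]
      exact Submodule.span_le_restrictScalars k (ResidueField O) _ ht
    rw [CotangentSpace.span_image_eq_top_iff] at hspan2
    have h3 := congrArg (Submodule.map (maximalIdeal O).subtype) hspan2
    rw [Submodule.map_span, ← Set.range_comp, Submodule.map_top, Submodule.range_subtype] at h3
    exact h3

variable {k : Type u} [Field k] {A B C : Type u} [CommRing A] [CommRing B] [CommRing C]
  [IsLocalRing A] [IsLocalRing B] [IsLocalRing C] [Algebra k A] [Algebra k B] [Algebra k C]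

/-- The linear map of cotangent spaces induced by a local homomorphism. -/
abbrev cotangentMap (f : A →ₐ[k] B) [IsLocalHom f] :
    CotangentSpace A →ₗ[k] CotangentSpace B :=
  Ideal.mapCotangent _ _ f (maximalIdeal_le_comap f)

theorem exists_mem_maximalIdeal_of_surjective (f : A →ₐ[k] B) (hf : Function.Surjective f) {b : B}
    (hb : b ∈ maximalIdeal B) : ∃ a ∈ maximalIdeal A, f a = b := by
  obtain ⟨a, rfl⟩ := hf b
  exact ⟨a, fun h => hb (h.map f), rfl⟩

theorem cotangentMap_surjective (f : A →ₐ[k] B) [IsLocalHom f] (hf : Function.Surjective f) :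
    Function.Surjective (cotangentMap f) := by
  intro t
  obtain ⟨⟨b, hb⟩, rfl⟩ := Ideal.toCotangent_surjective _ t
  obtain ⟨a, ha, rfl⟩ := exists_mem_maximalIdeal_of_surjective f hf hb
  exact ⟨Ideal.toCotangent _ ⟨a, ha⟩, rfl⟩

/-- If the kernel lay in `𝔪_A²`, the map of cotangent spaces would be injective, against the
dimensions. This supplies the coordinate `z`. -/
theorem exists_mem_ker_notMem_sq (f : A →ₐ[k] B) [IsLocalHom f] (hf : Function.Surjective f)
    [FiniteDimensional k (CotangentSpace B)]
    (hlt : Module.finrank k (CotangentSpace B) < Module.finrank k (CotangentSpace A)) :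
    ∃ z ∈ maximalIdeal A, f z = 0 ∧ z ∉ maximalIdeal A ^ 2 := by
  by_contra! hcon
  have hker : ∀ z, f z = 0 → z ∈ maximalIdeal A ^ 2 := fun z hz =>
    hcon z (fun h => by
      have := h.map f
      rw [hz] at this
      exact not_isUnit_zero this) hz
  have hmap : (maximalIdeal A).map f = maximalIdeal B := by
    refine le_antisymm (Ideal.map_le_iff_le_comap.mpr (maximalIdeal_le_comap f)) fun b hb => ?_
    obtain ⟨a, ha, rfl⟩ := exists_mem_maximalIdeal_of_surjective f hf hb
    exact Ideal.mem_map_of_mem f ha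
  have hinj : Function.Injective (cotangentMap f) := by
    rw [injective_iff_map_eq_zero]
    intro t ht
    obtain ⟨⟨a, ha⟩, rfl⟩ := Ideal.toCotangent_surjective _ t
    rw [Ideal.mapCotangent_toCotangent, Ideal.toCotangent_eq_zero] at ht
    rw [Ideal.toCotangent_eq_zero]
    change f a ∈ maximalIdeal B ^ 2 at ht
    rw [← hmap, ← Ideal.map_pow, Ideal.mem_map_iff_of_surjective f hf] at ht
    obtain ⟨a', ha', h⟩ := ht
    have := add_mem (hker (a - a') (by rw [map_sub, h, sub_self])) ha'
    rwa [sub_add_cancel] at this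
  exact absurd (LinearMap.finrank_le_finrank_of_injective hinj) (by omega)

/-- The kernel of the transpose is the annihilator of the range, so nothing is required of `E`,
which will be the cotangent space of `W`. -/
theorem finrank_range_of_finrank_ker_dualMap {E F : Type*} [AddCommGroup E] [Module k E]
    [AddCommGroup F] [Module k F] [FiniteDimensional k F] (L : E →ₗ[k] F) :
    Module.finrank k (LinearMap.range L) + Module.finrank k (LinearMap.ker L.dualMap) =
      Module.finrank k F := by
  rw [LinearMap.ker_dualMap_eq_dualAnnihilator_range]
  exact Subspace.finrank_add_finrank_dualAnnihilator_eq _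

/-- A basis of the target of a linear map adapted to its range. -/
theorem exists_basis_extending_range {E F : Type*} [AddCommGroup E] [Module k E]
    [AddCommGroup F] [Module k F] [FiniteDimensional k F] (L : E →ₗ[k] F) {m n : ℕ}
    (hm : Module.finrank k (LinearMap.range L) = m) (hn : Module.finrank k F = n + m) :
    ∃ b : Module.Basis (Fin n ⊕ Fin m) k F, ∀ j, b (Sum.inr j) ∈ LinearMap.range L := by
  obtain ⟨R', hR'⟩ := Submodule.exists_isCompl (LinearMap.range L)
  have h1 := Submodule.finrank_add_eq_of_isCompl hR'
  let b₁ := Module.finBasisOfFinrankEq k (LinearMap.range L) hm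
  let b₂ := Module.finBasisOfFinrankEq k R' (show Module.finrank k R' = n by omega)
  refine ⟨(b₂.prod b₁).map (Submodule.prodEquivOfIsCompl R' _ hR'.symm), fun j => ?_⟩
  rw [Module.Basis.map_apply, Submodule.coe_prodEquivOfIsCompl', Module.Basis.prod_apply_inr_fst,
    Module.Basis.prod_apply_inr_snd]
  simp

/-- The inclusion of the variables of the divisor `z = 0`. -/
def divisorVars (m : ℕ) : Fin 2 ⊕ Fin m ↪ Fin 3 ⊕ Fin m :=
  Fin.castSuccEmb.sumMap (Function.Embedding.refl _)

theorem range_divisorVars (m : ℕ) : Set.range (divisorVars m) = {Sum.inl 2}ᶜ := by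
  ext t
  constructor
  · rintro ⟨a | b, rfl⟩
    · fin_cases a <;> simp [divisorVars]
    · simp [divisorVars]
  · intro ht
    rcases t with t | t
    · fin_cases t
      · exact ⟨Sum.inl 0, rfl⟩
      · exact ⟨Sum.inl 1, rfl⟩
      · exact absurd rfl ht
    · exact ⟨Sum.inr t, rfl⟩

/-- Coordinates `x₁, x₂, z` and `x_j` of `A` adapted to a smooth divisor `B` and to a map
`C → A`. -/
theorem exists_adapted_coordinates (f : A →ₐ[k] B) [IsLocalHom f] (g : C →ₐ[k] A) [IsLocalHom g]
    [IsNoetherianRing A] [IsNoetherianRing B]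
    (hresA : ∀ a : A, ∃ c : k, a - algebraMap k A c ∈ maximalIdeal A)
    (hresB : ∀ a : B, ∃ c : k, a - algebraMap k B c ∈ maximalIdeal B)
    (hf : Function.Surjective f) (m : ℕ)
    (hA : Module.finrank k (CotangentSpace A) = m + 3)
    (hB : Module.finrank k (CotangentSpace B) = m + 2)
    (hker : Module.finrank k (LinearMap.ker (cotangentMap f ∘ₗ cotangentMap g).dualMap) = 2) :
    ∃ (x : Fin 3 ⊕ Fin m → A) (ξ : Fin 2 ⊕ Fin m → B), IsCoordinateSystem k x ∧
      IsCoordinateSystem k ξ ∧ (∀ t, f (x (divisorVars m t)) = ξ t) ∧ f (x (Sum.inl 2)) = 0 ∧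
      ∀ j, ∃ w, ξ (Sum.inr j) = f (g w) := by
  have hfinB : FiniteDimensional k (CotangentSpace B) :=
    FiniteDimensional.of_finrank_pos (by omega)
  have hrange := finrank_range_of_finrank_ker_dualMap (cotangentMap f ∘ₗ cotangentMap g)
  obtain ⟨b, hb⟩ := exists_basis_extending_range (cotangentMap f ∘ₗ cotangentMap g)
    (show _ = m by omega) (show _ = 2 + m by omega)
  have h1 : ∀ a : Fin 2, ∃ t : A, ∃ ht : t ∈ maximalIdeal A,
      (maximalIdeal B).toCotangent ⟨f t, maximalIdeal_le_comap f ht⟩ = b (Sum.inl a) := by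
    intro a
    obtain ⟨s, hs⟩ := cotangentMap_surjective f hf (b (Sum.inl a))
    obtain ⟨⟨t, ht⟩, rfl⟩ := Ideal.toCotangent_surjective _ s
    exact ⟨t, ht, hs⟩
  have h2 : ∀ j : Fin m, ∃ w : C, ∃ hw : w ∈ maximalIdeal C,
      (maximalIdeal B).toCotangent
        ⟨f (g w), maximalIdeal_le_comap f (maximalIdeal_le_comap g hw)⟩ = b (Sum.inr j) := by
    intro j
    obtain ⟨s, hs⟩ := hb j
    obtain ⟨⟨w, hw⟩, rfl⟩ := Ideal.toCotangent_surjective _ s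
    exact ⟨w, hw, hs⟩
  choose p hp hpb using h1
  choose w hw hwb using h2
  obtain ⟨z, hz, hfz, hz2⟩ := exists_mem_ker_notMem_sq f hf (by omega)
  let x : Fin 3 ⊕ Fin m → A := Sum.elim ![p 0, p 1, z] fun j => g (w j)
  let ξ : Fin 2 ⊕ Fin m → B := fun t => f (x (divisorVars m t))
  have hx : ∀ t, x t ∈ maximalIdeal A := by
    rintro (t | j)
    · fin_cases t
      · exact hp 0
      · exact hp 1
      · exact hz
    · exact maximalIdeal_le_comap g (hw j)
  have hξ : ∀ t, ξ t ∈ maximalIdeal B := fun t => maximalIdeal_le_comap f (hx _)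
  have hξb : ∀ t, (maximalIdeal B).toCotangent ⟨ξ t, hξ t⟩ = b t := by
    rintro (t | j)
    · fin_cases t
      · exact hpb 0
      · exact hpb 1
    · exact hwb j
  have hindep : ∀ c : Fin 2 ⊕ Fin m → k, ∑ t, c t • ξ t ∈ maximalIdeal B ^ 2 → c = 0 := by
    intro c hc
    have h3 : ∑ t, c t • b t = 0 := by
      have h4 : (maximalIdeal B).toCotangent (∑ t, c t • ⟨ξ t, hξ t⟩) = 0 := by
        rw [Ideal.toCotangent_eq_zero]
        convert hc
        simp
      rw [← h4, map_sum]
      refine Finset.sum_congr rfl fun t _ => ?_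
      rw [← hξb]
      exact (((maximalIdeal B).toCotangent.restrictScalars k).map_smul (c t) _).symm
    exact funext (Fintype.linearIndependent_iff.mp b.linearIndependent c h3)
  -- Restricting a relation to `B` kills every coefficient except that of `z`, and this one vanishes
  -- because `z ∉ 𝔪_A²`.
  have hindep' : ∀ c : Fin 3 ⊕ Fin m → k, ∑ t, c t • x t ∈ maximalIdeal A ^ 2 → c = 0 := by
    intro c hc
    have h3 : (fun t => c (divisorVars m t)) = 0 := by
      refine hindep _ ?_
      have h4 := Ideal.mem_map_of_mem f hc
      rw [Ideal.map_pow] at h4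
      have h5 := Ideal.pow_right_mono (Ideal.map_le_iff_le_comap.mpr (maximalIdeal_le_comap f)) 2 h4
      convert h5 using 1
      rw [Fintype.sum_sum_type, Fintype.sum_sum_type, Fin.sum_univ_two, Fin.sum_univ_three]
      simp only [map_add, map_sum, map_smul]
      have h6 : f (x (Sum.inl 2)) = 0 := hfz
      rw [h6, smul_zero, add_zero]
      rfl
    have h4 : ∀ t, t ≠ Sum.inl 2 → c t = 0 := fun t ht => by
      obtain ⟨s, rfl⟩ := (range_divisorVars m).ge ht
      exact congrFun h3 s
    rw [Fintype.sum_eq_single (Sum.inl 2) (fun t ht => by rw [h4 t ht, zero_smul])] at hc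
    have h5 : c (Sum.inl 2) = 0 := by
      by_contra h
      apply hz2
      have h6 := Submodule.smul_of_tower_mem (maximalIdeal A ^ 2) (c (Sum.inl 2))⁻¹ hc
      rwa [inv_smul_smul₀ h] at h6
    funext t
    by_cases ht : t = Sum.inl 2
    · rw [ht, h5]; rfl
    · exact h4 t ht
  exact ⟨x, ξ, isCoordinateSystem_of_indep hresA hx (by simp [hA]; omega) hindep',
    isCoordinateSystem_of_indep hresB hξ (by simp [hB]; omega) hindep, fun _ => rfl, hfz,
    fun j => ⟨w j, rfl⟩⟩

end Coordinates

/-! ### The completed maps in coordinates -/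

section Completion

open IsLocalRing

variable {k : Type u} [Field k] {A B C : Type u} [CommRing A] [CommRing B] [CommRing C]
  [IsLocalRing A] [IsLocalRing B] [IsLocalRing C] [Algebra k A] [Algebra k B] [Algebra k C]

theorem evalₐ_completionMap (f : A →ₐ[k] B) [IsLocalHom f] (n : ℕ) (a : Completion A) :
    AdicCompletion.evalₐ (maximalIdeal B) n (completionMap f a) =
      quotientPowMap f n (AdicCompletion.evalₐ (maximalIdeal A) n a) := by
  rw [completionMap, AdicCompletion.evalₐ_liftAlgHom]
  rfl

theorem completionMap_algebraMap (f : A →ₐ[k] B) [IsLocalHom f] (a : A) :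
    completionMap f (algebraMap A _ a) = algebraMap B _ (f a) := by
  refine AdicCompletion.ext_evalₐ fun n => ?_
  rw [evalₐ_completionMap, AlgHom.commutes, AlgHom.commutes]
  rfl

/-- Both sides agree on the variables, which suffices by `algHom_ext_of_map_X`. -/
theorem completionMap_comp_equiv {σ τ : Type*} [Fintype σ] [Fintype τ]
    [Algebra.FormallySmooth k A] [Algebra.FormallySmooth k B] (f : A →ₐ[k] B) [IsLocalHom f]
    {x : τ → A} {ξ : σ → B} (hx : IsCoordinateSystem k x) (hξ : IsCoordinateSystem k ξ)
    (e : σ ↪ τ) (he : ∀ s, f (x (e s)) = ξ s) (h0 : ∀ t ∉ Set.range e, f (x t) = 0) :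
    ((completionMap f).comp hx.equiv.toAlgHom) =
      hξ.equiv.toAlgHom.comp (MvPowerSeries.killCompl e) := by
  refine algHom_ext_of_map_X (y := fun t => f (x t))
    (fun t => maximalIdeal_le_comap f (hx.mem t)) (fun t => ?_) fun t => ?_
  · change completionMap f (hx.equiv (MvPowerSeries.X t)) = _
    rw [hx.equiv_X, completionMap_algebraMap]
  · change hξ.equiv (MvPowerSeries.killCompl e (MvPowerSeries.X t)) = _
    by_cases ht : t ∈ Set.range e
    · obtain ⟨s, rfl⟩ := ht
      rw [MvPowerSeries.killCompl_X, hξ.equiv_X, he]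
    · rw [MvPowerSeries.killCompl_X_eq_zero ht, map_zero, h0 t ht, map_zero]

variable {m : ℕ} [Algebra.FormallySmooth k A] [Algebra.FormallySmooth k B] {x : Fin 3 ⊕ Fin m → A}
  {ξ : Fin 2 ⊕ Fin m → B} (hx : IsCoordinateSystem k x) (hξ : IsCoordinateSystem k ξ)
  (f : A →ₐ[k] B) [IsLocalHom f]

/-- The isomorphism `R[[x₁, x₂, z]] ≃ Â` given by a coordinate system. -/
def coordinateEquiv : MvPowerSeries (Fin 3) (MvPowerSeries (Fin m) k) ≃ₐ[k] Completion A :=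
  ((sumEquiv (Fin 3) (Fin m) k).symm.trans hx.equiv : _ ≃ₐ[k] _)

theorem completionMap_equiv (hxξ : ∀ t, f (x (divisorVars m t)) = ξ t)
    (hz : f (x (Sum.inl 2)) = 0) (F : MvPowerSeries (Fin 3 ⊕ Fin m) k) :
    completionMap f (hx.equiv F) = hξ.equiv (MvPowerSeries.killCompl (divisorVars m) F) := by
  refine DFunLike.congr_fun (completionMap_comp_equiv f hx hξ (divisorVars m) hxξ
    fun t ht => ?_) F
  have : t = Sum.inl 2 := by
    by_contra h
    exact ht ((range_divisorVars m).ge h)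
  rw [this, hz]

theorem ker_completionMap_comp_coordinateEquiv (hξ : IsCoordinateSystem k ξ)
    (hxξ : ∀ t, f (x (divisorVars m t)) = ξ t)
    (hz : f (x (Sum.inl 2)) = 0) :
    RingHom.ker ((completionMap f).comp (coordinateEquiv hx).toAlgHom) =
      Ideal.span {MvPowerSeries.X 2} := by
  have h1 := ker_killCompl (R := k) (divisorVars m) (Sum.inl 2) (range_divisorVars m)
  ext F
  have h2 : F ∈ RingHom.ker ((completionMap f).comp (coordinateEquiv hx).toAlgHom) ↔
      (sumEquiv (Fin 3) (Fin m) k).symm F ∈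
        RingHom.ker (MvPowerSeries.killCompl (R := k) (divisorVars m)) := by
    rw [RingHom.mem_ker, RingHom.mem_ker]
    change completionMap f (hx.equiv _) = 0 ↔ _
    rw [completionMap_equiv hx hξ f hxξ hz, EmbeddingLike.map_eq_zero_iff]
    exact Iff.rfl
  rw [h2, h1, Ideal.mem_span_singleton, Ideal.mem_span_singleton,
    ← sumEquiv_X_inl (R := k) (τ := Fin m) (2 : Fin 3)]
  constructor
  · intro h
    simpa using map_dvd (sumEquiv (Fin 3) (Fin m) k) h
  · intro h
    simpa using map_dvd (sumEquiv (Fin 3) (Fin m) k).symm h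

theorem completionMap_comp_coordinateEquiv_surjective (hξ : IsCoordinateSystem k ξ)
    (hxξ : ∀ t, f (x (divisorVars m t)) = ξ t)
    (hz : f (x (Sum.inl 2)) = 0) :
    Function.Surjective ((completionMap f).comp (coordinateEquiv hx).toAlgHom) := by
  intro b
  obtain ⟨G, hG⟩ := killCompl_surjective (R := k) (divisorVars m) (hξ.equiv.symm b)
  refine ⟨sumEquiv (Fin 3) (Fin m) k G, ?_⟩
  change completionMap f (hx.equiv ((sumEquiv (Fin 3) (Fin m) k).symm _)) = b
  rw [AlgEquiv.symm_apply_apply, completionMap_equiv hx hξ f hxξ hz, hG,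
    AlgEquiv.apply_symm_apply]

/-- Monomials without `z` survive restriction to `z = 0`, where the vanishing derivatives in `x₁,
x₂` exclude odd exponents; monomials with `z` are unrestricted. -/
theorem coordinateEquiv_symm_mem_range_gammaHom [CharP k 2]
    (hxξ : ∀ t, f (x (divisorVars m t)) = ξ t)
    (hz : f (x (Sum.inl 2)) = 0) (g : C →ₐ[k] A) [IsLocalHom g]
    (hd : ∀ (a : Fin 2) (w : C),
      MvPowerSeries.pderiv k (Sum.inl a) (hξ.equiv.symm (algebraMap B _ (f (g w)))) = 0)
    (w : Completion C) :
    (coordinateEquiv hx).symm (completionMap g w) ∈ (gammaHom (MvPowerSeries (Fin m) k)).range := by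
  set G := hx.equiv.symm (completionMap g w) with hG
  refine mem_range_gammaHom _ fun n hn2 hn => ?_
  ext b
  change MvPowerSeries.coeff (n.sumElim b) G = 0
  let d : Fin 2 ⊕ Fin m →₀ ℕ := Finsupp.sumElim (Finsupp.equivFunOnFinite.symm ![n 0, n 1]) b
  have hd' : d.embDomain (divisorVars m) = n.sumElim b := by
    ext t
    by_cases ht : t ∈ Set.range (divisorVars m)
    · obtain ⟨s, rfl⟩ := ht
      rw [Finsupp.embDomain_apply_self]
      rcases s with s | s
      · fin_cases s <;> rfl
      · rfl
    · rw [Finsupp.embDomain_of_notMem_range _ _ _ ht]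
      have : t = Sum.inl 2 := by
        by_contra h
        exact ht ((range_divisorVars m).ge h)
      rw [this]
      exact hn2.symm
  rw [← hd', ← MvPowerSeries.coeff_killCompl]
  set F := MvPowerSeries.killCompl (R := k) (divisorVars m) G with hF
  have hF' : hξ.equiv F = completionMap f (completionMap g w) := by
    rw [hF, ← completionMap_equiv hx hξ f hxξ hz, hG, AlgEquiv.apply_symm_apply]
  -- The derivatives are known to vanish only for germs, so `w` is replaced by a germ `v` congruent
  -- to it modulo `𝔪 ^ (d.degree + 1)`, which leaves the coefficient at `d` unchanged.
  obtain ⟨v, hv⟩ := Ideal.Quotient.mk_surjective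
    (AdicCompletion.evalₐ (maximalIdeal C) (d.degree + 1) w)
  have h1 : MvPowerSeries.coeff d (F - hξ.equiv.symm (algebraMap B _ (f (g v)))) = 0 := by
    refine hξ.coeff_eq_zero_of_evalₐ_eq_zero (N := d.degree + 1) ?_ (Nat.lt_succ_self _)
    change AdicCompletion.evalₐ _ _ (hξ.equiv _) = 0
    rw [map_sub, map_sub, AlgEquiv.apply_symm_apply, hF', evalₐ_completionMap,
      evalₐ_completionMap, ← hv, AlgHom.commutes]
    exact sub_self _
  rw [map_sub, sub_eq_zero] at h1
  rw [h1]
  have h2 : ¬ Even (n 0) ∨ ¬ Even (n 1) := by tauto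
  rcases h2 with h | h
  · exact coeff_eq_zero_of_pderiv_eq_zero (hd 0 v) (Nat.not_even_iff_odd.mp h)
  · exact coeff_eq_zero_of_pderiv_eq_zero (hd 1 v) (Nat.not_even_iff_odd.mp h)

end Completion

/-! ### Morphisms of affine `k`-schemes -/

section Spec

variable {k : Type u} [Field k] {A B C : Type u} [CommRing A] [CommRing B] [CommRing C]
  [Algebra k A] [Algebra k B] [Algebra k C]

theorem specOverMap_comp (f : A →ₐ[k] B) (g : B →ₐ[k] C) :
    specOverMap (g.comp f) = specOverMap g ≫ specOverMap f := by
  ext1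
  exact Spec.map_comp (CommRingCat.ofHom f.toRingHom) (CommRingCat.ofHom g.toRingHom)

theorem specOverMap_id : specOverMap (AlgHom.id k A) = 𝟙 _ := by
  ext1
  exact Spec.map_id (.of A)

/-- The isomorphism of affine schemes given by an isomorphism of algebras. -/
def specOverIso (e : A ≃ₐ[k] B) : specOver k B ≅ specOver k A where
  hom := specOverMap e.toAlgHom
  inv := specOverMap e.symm.toAlgHom
  hom_inv_id := by
    rw [← specOverMap_comp, ← specOverMap_id]
    congr 1
    ext a
    exact e.apply_symm_apply a
  inv_hom_id := by
    rw [← specOverMap_comp, ← specOverMap_id]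
    congr 1
    ext a
    exact e.symm_apply_apply a

theorem exists_eq_specOverMap (ψ : specOver k B ⟶ specOver k A) :
    ∃ f : A →ₐ[k] B, ψ = specOverMap f := by
  obtain ⟨f, hf⟩ := Spec.map_surjective (R := .of A) (S := .of B) ψ.left
  have h := Over.w ψ
  have h2 : CommRingCat.ofHom (algebraMap k A) ≫ f = CommRingCat.ofHom (algebraMap k B) := by
    apply Spec.map_injective
    rw [Spec.map_comp, hf]
    exact h
  refine ⟨{ f.hom with commutes' := fun c => ?_ }, ?_⟩
  · exact congrArg (fun f => f.hom c) h2
  · ext1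
    exact hf.symm

theorem specOverMap_injective :
    Function.Injective (specOverMap : (A →ₐ[k] B) → (specOver k B ⟶ specOver k A)) := by
  intro f g h
  have h1 : Spec.map (CommRingCat.ofHom f.toRingHom) = Spec.map (CommRingCat.ofHom g.toRingHom) :=
    congrArg (fun t => t.left) h
  have h2 := congrArg CommRingCat.Hom.hom (Spec.map_injective h1)
  ext a
  exact RingHom.congr_fun h2 a

end Spec

/-! ### Factorization through `Γ^R` and the divisor `z = 0` -/

section Factorization

variable {k : Type u} [Field k] (R : Type u) [CommRing R] [Algebra k R]
  {D E : Type u} [CommRing D] [CommRing E] [Algebra k D] [Algebra k E]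

theorem kerLiftAlg_gammaHom_injective :
    Function.Injective ((Ideal.kerLiftAlg (gammaHom R)).restrictScalars k) :=
  RingHom.kerLift_injective (gammaHom R).toRingHom

/-- A homomorphism with values in the image of `(γ^R)^*` factors uniquely through `γ^R`. -/
theorem existsUnique_factor_gammaMap (τ : MvPowerSeries (Fin 3) R ≃ₐ[k] E) (T : D →ₐ[k] E)
    (hT : ∀ w, τ.symm (T w) ∈ (gammaHom R).range) :
    ∃! ψ : gammaScheme R k ⟶ specOver k D,
      specOverMap T = (specOverIso τ).hom ≫ gammaMap R k ≫ ψ := by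
  let κ := (Ideal.kerLiftAlg (gammaHom R)).restrictScalars k
  have hκ : Function.Injective κ := kerLiftAlg_gammaHom_injective R
  have hmem : ∀ w, (τ.symm.toAlgHom.comp T) w ∈ κ.range := fun w => by
    obtain ⟨g, hg⟩ := hT w
    exact ⟨Ideal.Quotient.mk _ g, hg⟩
  let p : D →ₐ[k] GammaRing R :=
    (AlgEquiv.ofInjective κ hκ).symm.toAlgHom.comp ((τ.symm.toAlgHom.comp T).codRestrict _ hmem)
  have hp : ∀ w, κ (p w) = τ.symm (T w) := fun w =>
    congrArg Subtype.val ((AlgEquiv.ofInjective κ hκ).apply_symm_apply ⟨_, hmem w⟩)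
  have hcomp : ∀ q : D →ₐ[k] GammaRing R, (specOverIso τ).hom ≫ gammaMap R k ≫ specOverMap q =
      specOverMap (τ.toAlgHom.comp (κ.comp q)) := fun q => by
    rw [specOverMap_comp, specOverMap_comp]
    exact (Category.assoc _ _ _).symm.trans (Category.assoc _ _ _)
  refine ⟨specOverMap p, ?_, ?_⟩
  · dsimp only
    rw [hcomp]
    congr 1
    ext w
    change T w = τ (κ (p w))
    rw [hp, AlgEquiv.apply_symm_apply]
  · intro ψ hψ
    obtain ⟨q, rfl⟩ := exists_eq_specOverMap (k := k) (A := D) (B := GammaRing R) ψ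
    have h1 := specOverMap_injective (hψ.trans (hcomp q))
    congr 1
    ext w
    -- Uniqueness: the coordinate ring of `Γ^R` embeds in `R[[x₁, x₂, z]]`.
    apply hκ
    rw [hp, h1]
    exact (τ.symm_apply_apply _).symm

/-- A surjection from `R[[x₁, x₂, z]]` with kernel `(z)` identifies its target with the
divisor `z = 0`. -/
theorem exists_iso_divisorZ (τ : MvPowerSeries (Fin 3) R ≃ₐ[k] E) (T : E →ₐ[k] D)
    (hs : Function.Surjective (T.comp τ.toAlgHom))
    (hk : RingHom.ker (T.comp τ.toAlgHom) = Ideal.span {MvPowerSeries.X 2}) :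
    ∃ e : specOver k D ≅ divisorZ R k,
      specOverMap T ≫ (specOverIso τ).hom = e.hom ≫ divisorZIncl R k := by
  let ε := (Ideal.quotientEquivAlgOfEq k hk.symm).trans
    (Ideal.quotientKerAlgEquivOfSurjective hs)
  refine ⟨specOverIso ε, ?_⟩
  change specOverMap T ≫ specOverMap τ.toAlgHom = specOverMap ε.toAlgHom ≫ specOverMap _
  rw [← specOverMap_comp, ← specOverMap_comp]
  rfl

end Factorization

/-! ### The kernel of the differential of `φ` restricted to `H` -/

section Tangent

variable {k : Type u} [Field k] {V W H : Over (Spec (.of k))} (φ : V ⟶ W) (i : H ⟶ V)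

theorem stalkPullback_surjective (hi : IsClosedImmersion i.left) (Q : H.left) :
    Function.Surjective (stalkPullback i Q) :=
  i.left.stalkMap_surjective Q

/-- A closed immersion is injective on tangent spaces, and the kernel lies in the image of `T_Q(H)`,
so its preimage has the same dimension. -/
theorem finrank_tangentKernel (hi : IsClosedImmersion i.left) (Q : H.left)
    (h2 : Module.finrank k (LinearMap.ker (tangentMap φ (i.left Q))) = 2)
    (hle : LinearMap.ker (tangentMap φ (i.left Q)) ≤ LinearMap.range (tangentMap i Q)) :
    Module.finrank k (tangentKernel φ i Q) = 2 := by
  have hinj : Function.Injective (tangentMap i Q) :=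
    LinearMap.dualMap_injective_of_surjective
      (cotangentMap_surjective _ (stalkPullback_surjective i hi Q))
  have h := (Submodule.equivMapOfInjective (tangentMap i Q) hinj (tangentKernel φ i Q)).finrank_eq
  rw [h, tangentKernel, Submodule.map_comap_eq, inf_eq_right.mpr hle, h2]

end Tangent

end InsepMap
end

theorem theorem3p1 {k : Type u} [Field k] [IsAlgClosed k] [CharP k 2]
    (V W H : Over (Spec (.of k)))
    (hV : InsepMap.IsVariety V) (hW : InsepMap.IsVariety W)
    (l : ℕ) (hl : 3 ≤ l) (hVsm : SmoothOfRelativeDimension l V.hom) (hWsm : Smooth W.hom)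
    (φ : V ⟶ W)
    (i : H ⟶ V) (hi : IsClosedImmersion i.left)
    (hHsm : SmoothOfRelativeDimension (l - 1) H.hom)
    (hker : ∀ P : H.left, IsClosed ({P} : Set H.left) →
      Module.finrank k (LinearMap.ker (InsepMap.tangentMap φ (i.left P))) = 2 ∧
      LinearMap.ker (InsepMap.tangentMap φ (i.left P)) ≤
        LinearMap.range (InsepMap.tangentMap i P))
    (P : H.left) (hP : IsClosed ({P} : Set H.left)) :
    ∃ ι : InsepMap.formalCompletion V (i.left P) ≅
        InsepMap.sourceSpec (MvPowerSeries (Fin (l - 3)) k) k,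
      (∃ e : InsepMap.formalCompletion H P ≅
          InsepMap.divisorZ (MvPowerSeries (Fin (l - 3)) k) k,
        InsepMap.formalCompletionMap i P ≫ ι.hom =
          e.hom ≫ InsepMap.divisorZIncl (MvPowerSeries (Fin (l - 3)) k) k) ∧
      ∃! ψ : InsepMap.gammaScheme (MvPowerSeries (Fin (l - 3)) k) k ⟶
          InsepMap.formalCompletion W (φ.left (i.left P)),
        InsepMap.formalCompletionMap φ (i.left P) =
          ι.hom ≫ InsepMap.gammaMap (MvPowerSeries (Fin (l - 3)) k) k ≫ ψ := by
  have hK := fun Q hQ => InsepMap.finrank_tangentKernel φ i hi Q (hker Q hQ).1 (hker Q hQ).2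
  have hVft := hV.locallyOfFiniteType
  have hHft : Smooth H.hom := SmoothOfRelativeDimension.smooth (l - 1) H.hom
  have hiP : IsClosed {i.left P} := by
    rw [← Set.image_singleton]
    exact i.left.isClosedEmbedding.isClosedMap _ hP
  obtain ⟨hVfs, hVn, hVd⟩ := InsepMap.smooth_stalk V l hVsm (i.left P) hiP
  obtain ⟨hHfs, hHn, hHd⟩ := InsepMap.smooth_stalk H (l - 1) hHsm P hP
  obtain ⟨x, ξ, hx, hξ, hxξ, hz, hw⟩ := InsepMap.exists_adapted_coordinates
    (InsepMap.stalkPullback i P) (InsepMap.stalkPullback φ (i.left P))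
    (InsepMap.exists_sub_algebraMap_mem V _ hiP) (InsepMap.exists_sub_algebraMap_mem H P hP)
    (InsepMap.stalkPullback_surjective i hi P) (l - 3) (by omega) (by omega) (hK P hP)
  let θ : H.left.presheaf.stalk P →ₐ[k] MvPowerSeries (Fin 2 ⊕ Fin (l - 3)) k :=
    hξ.equiv.symm.toAlgHom.comp ((Algebra.ofId (H.left.presheaf.stalk P) _).restrictScalars k)
  have hd : ∀ (a : Fin 2) (w : W.left.presheaf.stalk (φ.left (i.left P))),
      MvPowerSeries.pderiv k (Sum.inl a) (hξ.equiv.symm (algebraMap _ _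
        (InsepMap.stalkPullback i P (InsepMap.stalkPullback φ (i.left P) w)))) = 0 := by
    intro a w
    -- The exempt column is the other one of `x₁, x₂`, with index `1 - a` in `Fin 2`; the remaining
    -- coordinates are pulled back from `W` by `hw`.
    refine InsepMap.pderiv_stalkPullback_eq_zero φ i (l - 1) hHsm
      (fun Q hQ => (hK Q hQ).ge) P (by simp; omega) θ ξ hξ.equiv_symm_algebraMap (Sum.inl a)
      (Sum.inl (1 - a)) (fun j hj hj' => ?_) w
    rcases j with j | j
    · exfalso
      fin_cases a <;> fin_cases j <;> simp_all
    · exact hw j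
  refine ⟨InsepMap.specOverIso (InsepMap.coordinateEquiv hx), ?_, ?_⟩
  · exact InsepMap.exists_iso_divisorZ _ _ _
      (InsepMap.completionMap_comp_coordinateEquiv_surjective hx _ hξ hxξ hz)
      (InsepMap.ker_completionMap_comp_coordinateEquiv hx _ hξ hxξ hz)
  · exact InsepMap.existsUnique_factor_gammaMap _ _ _
      (InsepMap.coordinateEquiv_symm_mem_range_gammaHom hx hξ _ hxξ hz _ hd)
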